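/- Let $d\ge 1$ and let $f(z)=\prod_{j=1}^d (z-\zeta_j)$ be a complex polynomial with distinct roots $\zeta_j$, $|\zeta_j|<1$, and let $\mathcal C_f=\{c\in\mathbb C : f'(c)=0\}$. Let $\mathcal S=\{(z,w)\in\mathbb C^2 : w=f(z)\}$ be the branched Riemann surface of $f^{-1}$, with the bijection $\widehat f:\mathbb C\to\mathcal S$, $\widehat f(z)=(z,f(z))$, and the projection $\pi:\mathcal S\to\mathbb C$, $\pi(z,w)=w$. Equip $\mathcal S$ with the metric $\operatorname{dist}(u,u')$ given by the infimum of the Euclidean lengths of $\pi\circ\gamma$ over all paths $\gamma$ in $\mathcal S$ from $u$ to $u'$. For $c\in\mathcal C_f$ let $$\operatorname{Vor}(\widehat f(c))=\{u\in\mathcal S : \operatorname{dist}(u,\widehat f(c))\le \operatorname{dist}(u,\widehat f(c'))\ \text{for all } c'\in\mathcal C_f\}.$$ Say that $c\in\mathcal C_f$ influences the orbit of $z\in\mathbb C$ if, for some $\widehat 0\in\mathcal S$ with $\pi(\widehat 0)=0$, the segment $[0,f(z)]$ has a lift to $\mathcal S$ which starts at $\widehat 0$, ends at $\widehat f(z)$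 and meets $\operatorname{Vor}(\widehat f(c))$. For $z$ with $|z|>1$ let $$\beta^+(z)=\operatorname{card}\Bigl\{c\in\mathcal C_f : c \text{ influences the orbit of } z \text{ and } -\tfrac{\pi}{2}<\operatorname{Arg}\tfrac{f(z)}{f(c)}<\tfrac{\pi}{2}\Bigr\},$$ where $\operatorname{Arg}$ takes values in $(-\pi,\pi]$. Then for every $r>1$ the function $t\mapsto\beta^+(re^{2\pi i t})$ is integrable on $[0,1]$ and $$\int_0^1 \beta^+(re^{2\pi i t})\,dt\le\frac{1+r}{r}.$$ -/

import Mathlib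

noncomputable section

namespace PathLifting

/-- `f` belongs to the class `𝒫_d(1)`: it is a monic polynomial `∏ (z - ζ_j)` of degree `d` with
distinct roots `ζ_1, …, ζ_d` in the open unit disk. -/
def IsPd1 (d : ℕ) (f : Polynomial ℂ) : Prop :=
  ∃ ζ : Fin d → ℂ, Function.Injective ζ ∧ (∀ j, ‖ζ j‖ < 1) ∧
    f = ∏ j, (Polynomial.X - Polynomial.C (ζ j))

/-- The critical points `{z | f'(z) = 0}` in the source plane. -/
def criticalPoints (f : Polynomial ℂ) : Set ℂ :=
  {z | f.derivative.eval z = 0}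

/-- The branched Riemann surface of `f⁻¹`, that is, the curve `{(z, w) | w = f(z)}`, with the
topology of a subspace of `ℂ × ℂ`. -/
def Surface (f : Polynomial ℂ) : Type :=
  {p : ℂ × ℂ // p.2 = f.eval p.1}

instance (f : Polynomial ℂ) : TopologicalSpace (Surface f) :=
  inferInstanceAs (TopologicalSpace {p : ℂ × ℂ // p.2 = f.eval p.1})

/-- The bijection `f̂ : ℂ → 𝒮` from the source plane onto the surface. -/
def fhat (f : Polynomial ℂ) (z : ℂ) : Surface f :=
  ⟨(z, f.eval z), rfl⟩

/-- The branched covering `π : 𝒮 → ℂ` onto the target plane; one has `π ∘ f̂ = f`. -/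
def proj (f : Polynomial ℂ) (u : Surface f) : ℂ :=
  u.1.2

theorem proj_fhat (f : Polynomial ℂ) (z : ℂ) : proj f (fhat f z) = f.eval z :=
  rfl

/-- The length of a path on the surface: the Euclidean length (total variation) of its projection
to the target plane. -/
def pathLength (f : Polynomial ℂ) {u v : Surface f} (γ : Path u v) : ENNReal :=
  eVariationOn (fun s : unitInterval => proj f (γ s)) Set.univ

/-- The metric of the surface, for which `π` is a local isometry away from the branch points:
the infimum of the lengths of the paths on the surface that join the two points. -/
def surfaceDist (f : Polynomial ℂ) (u v : Surface f) : ENNReal :=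
  ⨅ γ : Path u v, pathLength f γ

/-- The critical values in the surface: the points `f̂(c)` with `c` a critical point. -/
def criticalValues (f : Polynomial ℂ) : Set (Surface f) :=
  fhat f '' criticalPoints f

/-- The Voronoi domain of `v`: the points of the surface that are at least as close to `v` as to
any critical value in the surface. -/
def voronoi (f : Polynomial ℂ) (v : Surface f) : Set (Surface f) :=
  {u | ∀ v' ∈ criticalValues f, surfaceDist f u v ≤ surfaceDist f u v'}

/-- The lifted segment: the points on a lift to the surface of the segment `[π(u₁), π(u₂)]` that
starts at `u₁` and ends at `u₂`; the empty set if there is no such lift. -/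
def liftSeg (f : Polynomial ℂ) (u₁ u₂ : Surface f) : Set (Surface f) :=
  {p | ∃ γ : Path u₁ u₂,
    (∀ s : unitInterval,
      proj f (γ s) = AffineMap.lineMap (proj f u₁) (proj f u₂) (s : ℝ)) ∧
    p ∈ Set.range γ}

/-- The critical point `c` influences the orbit of `z`: the lifted segment from a point `o` of the
surface above `0` to `f̂(z)` meets the Voronoi domain of `f̂(c)`. -/
def Influences (f : Polynomial ℂ) (c z : ℂ) : Prop :=
  ∃ o : Surface f, proj f o = 0 ∧ (liftSeg f o (fhat f z) ∩ voronoi f (fhat f c)).Nonempty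

/-- The angle in `(-π, π]` from `[0, f(c)]` to `[0, f(z)]`. -/
def angle (f : Polynomial ℂ) (z c : ℂ) : ℝ :=
  Complex.arg (f.eval z / f.eval c)

/-- `β⁺(z)`: the number of critical points `c` that influence the orbit of `z` and whose critical
value lies in the same open half-plane as `f(z)`, i.e. at an angle in `(-π/2, π/2)`. -/
def betaPlus (f : Polynomial ℂ) (z : ℂ) : ℕ :=
  {c ∈ criticalPoints f | Influences f c z ∧
    -(Real.pi / 2) < angle f z c ∧ angle f z c < Real.pi / 2}.ncard

/-- The point `r e^{2πit}`. -/
def circlePoint (r t : ℝ) : ℂ :=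
  (r : ℂ) * Complex.exp (2 * (Real.pi : ℂ) * Complex.I * (t : ℂ))

end PathLifting

end

open Set Filter Topology Polynomial
open scoped NNReal ENNReal ComplexConjugate

namespace PathLifting

/-! Since β⁺ counts critical points, its integral is the sum over c of the measure of E_c, the set
of parameters t for which c influences the orbit of re^{2πit} at an acute angle. Each E_c is bounded
separately, in terms of the multiplicity m of c as a zero of f'.

Fix a ray from 0 that carries no critical value, and let z with |z| = r lie over it. If the lift of
[0, f(z)] meets the Voronoi domain at f̂(a), no critical value on the surface is closer to f̂(a)
than f̂(c). Hence f has an inverse branch on the disk about f(a) with f(c) on its boundary, and the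
branch tends to c there (`exists_branch_of_mem_voronoi`). As the angle is acute, the perpendicular
from f(c) has its foot on the ray; it runs inside this disk, so it lifts to a curve from c to the
lifted ray (`exists_perpendicular_lift`). Curves of distinct z are disjoint: if two meet, they end
on one lifted ray, along which the modulus increases strictly outside the unit disk and takes the
value r only once. Near c the map f is (m+1)-to-one, so there are at most m+1 such z over the ray
(`card_influenced_le`).

Along the circle the argument of f turns at speed at least λ = 2πdr/(1+r), and the acute directions
fill an interval of length π. So E_c has measure at most (m+1)π/λ = (m+1)(1+r)/(2dr)
(`volume_le_of_multiplicity`, `volume_influenceSet_le`). Finally m+1 ≤ 2m, and the multiplicities m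
add up to at most d. -/

/-! ### The surface distance: triangle inequality, continuity, finiteness. -/

theorem continuous_fhat (f : ℂ[X]) : Continuous (fhat f) :=
  Continuous.subtype_mk (continuous_id.prodMk f.continuous) _

/-- The coordinate `z` on the surface, the inverse of `fhat`. -/
def coord (f : ℂ[X]) (u : Surface f) : ℂ := u.1.1

theorem continuous_coord (f : ℂ[X]) : Continuous (coord f) :=
  continuous_fst.comp continuous_subtype_val

theorem fhat_coord (f : ℂ[X]) (u : Surface f) : fhat f (coord f u) = u :=
  Subtype.ext (Prod.ext rfl u.2.symm)

theorem coord_fhat (f : ℂ[X]) (z : ℂ) : coord f (fhat f z) = z := rfl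

theorem proj_eq_eval_coord (f : ℂ[X]) (u : Surface f) : proj f u = f.eval (coord f u) := u.2

theorem surfaceDist_triangle (f : ℂ[X]) (u v w : Surface f) :
    surfaceDist f u w ≤ surfaceDist f u v + surfaceDist f v w := by
  refine ENNReal.le_iInf_add_iInf fun γ γ' => (iInf_le _ (γ.trans γ')).trans ?_
  have h : eVariationOn (fun s : unitInterval => proj f ((γ.trans γ') s)) univ
      = eVariationOn (fun s : unitInterval => proj f ((γ.trans γ') s))
          {s : unitInterval | (s : ℝ) ≤ 1 / 2}
        + eVariationOn (fun s : unitInterval => proj f ((γ.trans γ') s))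
          {s : unitInterval | 1 / 2 ≤ (s : ℝ)} := by
    rw [← eVariationOn.union (x := ⟨1 / 2, by norm_num, by norm_num⟩)]
    · congr 1
      ext s
      simpa using le_total (s : ℝ) 2⁻¹
    · exact ⟨by simp, fun s hs => Subtype.coe_le_coe.1 (by simpa using hs)⟩
    · exact ⟨by simp, fun s hs => Subtype.coe_le_coe.1 (by simpa using hs)⟩
  unfold pathLength
  rw [h]
  gcongr
  · set φ : unitInterval → unitInterval := fun s => Set.projIcc 0 1 zero_le_one (2 * (s : ℝ))
    have hφ : Monotone φ := fun a b hab =>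
      Set.monotone_projIcc _ (by have : (a : ℝ) ≤ b := hab; linarith)
    refine le_trans (le_of_eq ?_) (eVariationOn.comp_le_of_monotoneOn
      (fun s : unitInterval => proj f (γ s)) (t := {s : unitInterval | (s : ℝ) ≤ 1 / 2}) φ
      (hφ.monotoneOn _) (fun _ _ => mem_univ _))
    refine eVariationOn.congr fun s hs => ?_
    have hs' : (s : ℝ) ≤ 1 / 2 := hs
    simp only [Function.comp, Path.trans_apply, dif_pos hs', φ]
    congr 2
    rw [Set.projIcc_of_mem]
  · set φ : unitInterval → unitInterval := fun s => Set.projIcc 0 1 zero_le_one (2 * (s : ℝ) - 1)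
    have hφ : Monotone φ := fun a b hab =>
      Set.monotone_projIcc _ (by have : (a : ℝ) ≤ b := hab; linarith)
    refine le_trans (le_of_eq ?_) (eVariationOn.comp_le_of_monotoneOn
      (fun s : unitInterval => proj f (γ' s)) (t := {s : unitInterval | 1 / 2 ≤ (s : ℝ)}) φ
      (hφ.monotoneOn _) (fun _ _ => mem_univ _))
    refine eVariationOn.congr fun s hs => ?_
    have hs' : 1 / 2 ≤ (s : ℝ) := hs
    simp only [Function.comp, Path.trans_apply, φ]
    split_ifs with h2
    · have h3 : (s : ℝ) = 1 / 2 := le_antisymm h2 hs'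
      simp [h3]
    · congr 2
      rw [Set.projIcc_of_mem]

theorem surfaceDist_comm_le (f : ℂ[X]) (u v : Surface f) :
    surfaceDist f u v ≤ surfaceDist f v u := by
  refine le_iInf fun γ => (iInf_le _ γ.symm).trans ?_
  exact eVariationOn.comp_le_of_antitoneOn (fun s : unitInterval => proj f (γ s)) (t := univ)
    unitInterval.symm (fun a _ b _ hab => unitInterval.symm_le_symm.2 hab) (fun _ _ => mem_univ _)

theorem surfaceDist_comm (f : ℂ[X]) (u v : Surface f) : surfaceDist f u v = surfaceDist f v u :=
  le_antisymm (surfaceDist_comm_le f u v) (surfaceDist_comm_le f v u)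

theorem surfaceDist_le_of_curve (f : ℂ[X]) {σ : ℝ → ℂ} {S : ℝ} (hS : 0 ≤ S)
    (hσ : ContinuousOn σ (Icc 0 S)) :
    surfaceDist f (fhat f (σ 0)) (fhat f (σ S)) ≤ eVariationOn (fun s => f.eval (σ s)) (Icc 0 S) := by
  have hmem : ∀ s : unitInterval, (s : ℝ) * S ∈ Icc 0 S := fun s =>
    ⟨mul_nonneg s.2.1 hS, mul_le_of_le_one_left hS s.2.2⟩
  let γ : Path (fhat f (σ 0)) (fhat f (σ S)) :=
    { toFun := fun s => fhat f (σ (s * S))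
      continuous_toFun := (continuous_fhat f).comp
        (hσ.comp_continuous (by fun_prop) hmem)
      source' := by simp
      target' := by simp }
  refine (iInf_le _ γ).trans ?_
  exact eVariationOn.comp_le_of_monotoneOn (fun s : ℝ => f.eval (σ s)) (t := univ)
    (fun s : unitInterval => (s : ℝ) * S)
    (fun a _ b _ hab => mul_le_mul_of_nonneg_right (Subtype.coe_le_coe.2 hab) hS) (fun s _ => hmem s)

theorem eVariationOn_le_of_lipschitzOnWith {g : ℝ → ℂ} {K : ℝ≥0} {S : ℝ} (hS : 0 ≤ S)
    (hg : LipschitzOnWith K g (Icc 0 S)) :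
    eVariationOn g (Icc 0 S) ≤ K * ENNReal.ofReal S := by
  have h := hg.comp_eVariationOn_le (g := id) (s := Icc 0 S) (mapsTo_id _)
  refine h.trans ?_
  gcongr
  have := (monotoneOn_id (s := Icc (0 : ℝ) S)).eVariationOn_eq (left_mem_Icc.2 hS)
    (right_mem_Icc.2 hS)
  simpa only [inter_self, id, sub_zero] using this.le

/-- The image under f of the segment from z to z' has length at most sup |f'| times |z' - z|. This
comparison makes the surface distance continuous in the coordinate z, and finite. -/
theorem surfaceDist_le_mul_norm (f : ℂ[X]) (M : ℝ) : ∃ L : ℝ≥0, ∀ z z' : ℂ, ‖z‖ ≤ M → ‖z'‖ ≤ M →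
    surfaceDist f (fhat f z) (fhat f z') ≤ L * ENNReal.ofReal ‖z' - z‖ := by
  obtain ⟨B, hB⟩ := (isCompact_closedBall (0 : ℂ) M).exists_bound_of_continuousOn
    f.derivative.continuous.continuousOn
  have hlip : LipschitzOnWith B.toNNReal (fun z => f.eval z) (Metric.closedBall 0 M) := by
    refine (convex_closedBall (0 : ℂ) M).lipschitzOnWith_of_nnnorm_hasDerivWithin_le
      (f' := fun z => f.derivative.eval z)
      (fun z _ => (f.hasDerivAt z).hasDerivWithinAt) fun z hz => ?_
    exact NNReal.le_toNNReal_of_coe_le (hB z hz)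
  refine ⟨B.toNNReal, fun z z' hz hz' => ?_⟩
  have hl : LipschitzWith ‖z' - z‖₊ (fun s : ℝ => (AffineMap.lineMap z z' s : ℂ)) := by
    refine LipschitzWith.of_dist_le_mul fun a b => ?_
    rw [dist_lineMap_lineMap, dist_comm z, dist_eq_norm z', mul_comm]; rfl
  have h := surfaceDist_le_of_curve f (σ := fun s : ℝ => AffineMap.lineMap z z' s) zero_le_one
    hl.continuous.continuousOn
  simp only [AffineMap.lineMap_apply_zero, AffineMap.lineMap_apply_one] at h
  refine h.trans ?_
  have hm : MapsTo (fun s : ℝ => (AffineMap.lineMap z z' s : ℂ)) (Icc 0 1)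
      (Metric.closedBall 0 M) := fun s hs =>
    (convex_closedBall (0 : ℂ) M).lineMap_mem (by simpa using hz) (by simpa using hz') hs
  refine (eVariationOn_le_of_lipschitzOnWith zero_le_one
    (hlip.comp (hl.lipschitzOnWith (s := Icc 0 1)) hm)).trans ?_
  simp [ENNReal.ofReal, norm_toNNReal]

theorem continuous_surfaceDist_left (f : ℂ[X]) (v : Surface f) :
    Continuous fun z => surfaceDist f (fhat f z) v := by
  rw [continuous_iff_continuousAt]
  intro z₀
  obtain ⟨L, hL⟩ := surfaceDist_le_mul_norm f (‖z₀‖ + 1)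
  have hev : ∀ᶠ z in 𝓝 z₀, ‖z‖ ≤ ‖z₀‖ + 1 :=
    (continuous_norm.tendsto z₀).eventually_le_const (by linarith)
  have hlim : Tendsto (fun z => (L : ℝ≥0∞) * ENNReal.ofReal ‖z - z₀‖) (𝓝 z₀) (𝓝 0) := by
    have h : Continuous fun z : ℂ => ENNReal.ofReal ‖z - z₀‖ :=
      ENNReal.continuous_ofReal.comp (by fun_prop)
    have h2 := ENNReal.Tendsto.const_mul (a := (L : ℝ≥0∞)) (h.tendsto z₀)
      (Or.inr ENNReal.coe_ne_top)
    simpa using h2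
  by_cases htop : surfaceDist f (fhat f z₀) v = ⊤
  · refine (tendsto_const_nhds (x := surfaceDist f (fhat f z₀) v)).congr' ?_
    filter_upwards [hev] with z hz
    have h := surfaceDist_triangle f (fhat f z₀) (fhat f z) v
    have h2 := hL z₀ z (by linarith) hz
    rw [htop, top_le_iff, ENNReal.add_eq_top] at h
    rcases h with h | h
    · exact absurd (h ▸ h2) (by simp [ENNReal.mul_eq_top])
    · rw [htop, h]
  · refine (ENNReal.tendsto_nhds htop).2 fun ε hε => ?_
    filter_upwards [hev, hlim.eventually_le_const hε] with z hz hz'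
    have h1 := surfaceDist_triangle f (fhat f z₀) (fhat f z) v
    have h2 := surfaceDist_triangle f (fhat f z) (fhat f z₀) v
    have h3 := (hL z₀ z (by linarith) hz).trans hz'
    have h4 : surfaceDist f (fhat f z) (fhat f z₀) ≤ ε := by rw [surfaceDist_comm]; exact h3
    refine ⟨tsub_le_iff_left.2 (h1.trans (by gcongr)), h2.trans ?_⟩
    rw [add_comm]; gcongr

theorem continuous_surfaceDist_right (f : ℂ[X]) (v : Surface f) :
    Continuous fun z => surfaceDist f v (fhat f z) := by
  simpa only [surfaceDist_comm f v] using continuous_surfaceDist_left f v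

theorem surfaceDist_ne_top (f : ℂ[X]) (z z' : ℂ) : surfaceDist f (fhat f z) (fhat f z') ≠ ⊤ := by
  obtain ⟨L, hL⟩ := surfaceDist_le_mul_norm f (max ‖z‖ ‖z'‖)
  exact ne_top_of_le_ne_top (by simp [ENNReal.mul_eq_top])
    (hL z z' (le_max_left _ _) (le_max_right _ _))

theorem isClosed_preimage_voronoi (f : ℂ[X]) (v : Surface f) :
    IsClosed (fhat f ⁻¹' voronoi f v) := by
  have : fhat f ⁻¹' voronoi f v = ⋂ v' ∈ criticalValues f,
      {z | surfaceDist f (fhat f z) v ≤ surfaceDist f (fhat f z) v'} := by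
    ext z; simp [voronoi]
  rw [this]
  exact isClosed_biInter fun v' _ =>
    isClosed_le (continuous_surfaceDist_left f v) (continuous_surfaceDist_left f v')

/-! ### Local inverses of f and lifting of paths. -/

/-- A connected set on which `f` is close to `f c` and that comes close to `c` stays close
to `c`. -/
theorem exists_trap {f : ℂ[X]} (hf : f.derivative ≠ 0) (c : ℂ) {η : ℝ} (hη : 0 < η) :
    ∃ δ > 0, ∃ η' > 0, ∀ S : Set ℂ, IsPreconnected S →
      (S ∩ Metric.ball c η').Nonempty → (∀ z ∈ S, ‖f.eval z - f.eval c‖ < δ) →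
      S ⊆ Metric.ball c η := by
  have hne : f - C (f.eval c) ≠ 0 := by
    intro h
    apply hf
    have := congrArg derivative h
    simpa using this
  have hfin : {x : ℂ | f.eval x = f.eval c}.Finite := by
    refine ((f - C (f.eval c)).rootSet_finite ℂ).subset fun x hx => ?_
    rw [mem_rootSet]
    exact ⟨hne, by simpa [sub_eq_zero] using hx⟩
  have hfin2 : ((fun x => dist x c) '' {x : ℂ | f.eval x = f.eval c}).Finite := hfin.image _
  -- The radius η' avoids the finitely many distances from c to points of its fibre, so |f - f c|
  -- has a positive minimum on the sphere of radius η'; a connected set on which it stays smaller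
  -- cannot cross.
  obtain ⟨η', ⟨h1, h2⟩, h3⟩ :=
    ((Set.Ioo_infinite hη).sdiff hfin2).nonempty
  have hsph : ∀ z ∈ Metric.sphere c η', 0 < ‖f.eval z - f.eval c‖ := by
    intro z hz
    rw [norm_pos_iff, sub_ne_zero]
    exact fun h => h3 ⟨z, h, hz⟩
  obtain ⟨δ, hδ, hδ'⟩ := (isCompact_sphere c η').exists_forall_le' (f := fun z =>
    ‖f.eval z - f.eval c‖) (by fun_prop) hsph
  refine ⟨δ, hδ, η', h1, fun S hS hSb hSf => ?_⟩
  refine (hS.subset_left_of_subset_union Metric.isOpen_ball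
    (v := (Metric.closedBall c η')ᶜ) Metric.isClosed_closedBall.isOpen_compl
    (disjoint_compl_right.mono_left Metric.ball_subset_closedBall) (fun z hz => ?_) hSb).trans
    (Metric.ball_subset_ball h2.le)
  by_contra hcon
  simp only [mem_union, Metric.mem_ball, mem_compl_iff, Metric.mem_closedBall, not_or, not_lt,
    not_le] at hcon
  exact (hSf z hz).not_ge (hδ' z (le_antisymm hcon.2 hcon.1))

theorem exists_localHomeo (f : ℂ[X]) {y : ℂ} (hy : f.derivative.eval y ≠ 0) :
    ∃ e : OpenPartialHomeomorph ℂ ℂ, y ∈ e.source ∧ ∀ z, e z = f.eval z :=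
  ⟨_, ((f.hasStrictDerivAt y).hasStrictFDerivAt_equiv hy).mem_toOpenPartialHomeomorph_source,
    fun _ => rfl⟩

/-- Two lifts of the same map to the `z`-plane, one of which avoids the critical points, agree on
a connected set if they agree at a point. -/
theorem eqOn_of_eval_eq {X : Type*} [TopologicalSpace X] (f : ℂ[X]) {g₁ g₂ : X → ℂ} {S : Set X}
    (hS : IsPreconnected S) (h₁ : ContinuousOn g₁ S) (h₂ : ContinuousOn g₂ S)
    (hcrit : ∀ x ∈ S, f.derivative.eval (g₁ x) ≠ 0)
    (heq : ∀ x ∈ S, f.eval (g₁ x) = f.eval (g₂ x)) {x₀ : X} (hx₀ : x₀ ∈ S) (h₀ : g₁ x₀ = g₂ x₀) :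
    EqOn g₁ g₂ S := by
  have : PreconnectedSpace S := Subtype.preconnectedSpace hS
  have c₁ : Continuous fun x : S => g₁ x := continuousOn_iff_continuous_domRestrict.1 h₁
  have c₂ : Continuous fun x : S => g₂ x := continuousOn_iff_continuous_domRestrict.1 h₂
  have hclopen : IsClopen {x : S | g₁ x = g₂ x} := by
    refine ⟨isClosed_eq c₁ c₂, isOpen_iff_mem_nhds.2 fun x hx => ?_⟩
    obtain ⟨e, hxe, he⟩ := exists_localHomeo f (hcrit x x.2)
    have hs := e.open_source.mem_nhds hxe
    have hs2 : e.source ∈ 𝓝 (g₂ x) := by rw [← show g₁ x = g₂ x from hx]; exact hs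
    filter_upwards [c₁.continuousAt hs, c₂.continuousAt hs2] with y hy1 hy2
    exact e.injOn hy1 hy2 (by rw [he, he, heq y y.2])
  have := hclopen.eq_univ ⟨⟨x₀, hx₀⟩, h₀⟩
  exact fun x hx => (Set.eq_univ_iff_forall.1 this ⟨x, hx⟩ : _)

/-- A local inverse on the disk of radius ε about f x serves, with radius ε / 2, every y near x with
|f y - f x| < ε / 2. Compactness makes the radius uniform. -/
theorem exists_uniform_inverse (f : ℂ[X]) {K : Set ℂ} (hK : IsCompact K)
    (hcrit : ∀ y ∈ K, f.derivative.eval y ≠ 0) :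
    ∃ ε > 0, ∀ y ∈ K, ∃ φ : ℂ → ℂ, ContinuousOn φ (Metric.ball (f.eval y) ε) ∧
      (∀ w ∈ Metric.ball (f.eval y) ε, f.eval (φ w) = w) ∧ φ (f.eval y) = y := by
  refine hK.induction_on (p := fun S => ∃ ε > 0, ∀ y ∈ S, ∃ φ : ℂ → ℂ,
      ContinuousOn φ (Metric.ball (f.eval y) ε) ∧
      (∀ w ∈ Metric.ball (f.eval y) ε, f.eval (φ w) = w) ∧ φ (f.eval y) = y) ?_ ?_ ?_ ?_
  · exact ⟨1, one_pos, fun y hy => hy.elim⟩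
  · rintro s t hst ⟨ε, hε, h⟩
    exact ⟨ε, hε, fun y hy => h y (hst hy)⟩
  · rintro s t ⟨ε, hε, h⟩ ⟨ε', hε', h'⟩
    refine ⟨min ε ε', lt_min hε hε', fun y hy => ?_⟩
    rcases hy with hy | hy
    · obtain ⟨φ, h1, h2, h3⟩ := h y hy
      have hs := Metric.ball_subset_ball (x := f.eval y) (min_le_left ε ε')
      exact ⟨φ, h1.mono hs, fun w hw => h2 w (hs hw), h3⟩
    · obtain ⟨φ, h1, h2, h3⟩ := h' y hy
      have hs := Metric.ball_subset_ball (x := f.eval y) (min_le_right ε ε')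
      exact ⟨φ, h1.mono hs, fun w hw => h2 w (hs hw), h3⟩
  · intro x hx
    obtain ⟨e, hxe, he⟩ := exists_localHomeo f (hcrit x hx)
    obtain ⟨ε, hε, hball⟩ := Metric.isOpen_iff.1 e.open_target _ (e.map_source hxe)
    rw [he] at hball
    have hc : {y | f.eval y ∈ Metric.ball (f.eval x) (ε / 2)} ∈ 𝓝 x :=
      f.continuous.continuousAt (Metric.ball_mem_nhds _ (half_pos hε))
    refine ⟨_, mem_nhdsWithin_of_mem_nhds (inter_mem (e.open_source.mem_nhds hxe) hc),
      ε / 2, half_pos hε, fun y hy => ⟨e.symm, ?_, ?_, ?_⟩⟩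
    · exact e.continuousOn_symm.mono ((Metric.ball_subset_ball' (by
        have : dist (f.eval y) (f.eval x) < ε / 2 := hy.2
        linarith)).trans hball)
    · intro w hw
      rw [← he, e.right_inv]
      refine hball (Metric.ball_subset_ball' ?_ hw)
      have : dist (f.eval y) (f.eval x) < ε / 2 := hy.2
      linarith
    · rw [← he, e.left_inv hy.1]

/-- A path lifts from a given starting point, provided that the lifts of its initial pieces stay in
a closed set free of critical points. -/
theorem exists_lift {f : ℂ[X]} (hf : 0 < f.degree) {w : ℝ → ℂ} (hw : ContinuousOn w (Icc 0 1))
    {a : ℂ} (ha : f.eval a = w 0) {K : Set ℂ} (hK : IsClosed K)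
    (hcrit : ∀ y ∈ K, f.derivative.eval y ≠ 0)
    (hstay : ∀ S ∈ Icc (0 : ℝ) 1, ∀ σ : ℝ → ℂ, ContinuousOn σ (Icc 0 S) → σ 0 = a →
      (∀ s ∈ Icc 0 S, f.eval (σ s) = w s) → σ S ∈ K) :
    ∃ σ : ℝ → ℂ, ContinuousOn σ (Icc 0 1) ∧ σ 0 = a ∧
      (∀ s ∈ Icc (0 : ℝ) 1, f.eval (σ s) = w s) ∧ ∀ s ∈ Icc (0 : ℝ) 1, σ s ∈ K := by
  -- A nonconstant polynomial is proper, so all lifts of the path that stay in K lie in one compact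
  -- set. Inverse branches exist there on disks of a common radius ε, and the lift is extended in n
  -- + 1 steps, each too short for w to leave such a disk.
  have hcpt : IsCompact (K ∩ (fun z => f.eval z) ⁻¹' (w '' Icc 0 1)) :=
    ((f.isProperMap_eval hf).isCompact_preimage (isCompact_Icc.image_of_continuousOn hw)).inter_left
      hK
  obtain ⟨ε, hε, hinv⟩ := exists_uniform_inverse f hcpt fun y hy => hcrit y hy.1
  obtain ⟨δ, hδ, hunif⟩ := Metric.uniformContinuousOn_iff.1
    (isCompact_Icc.uniformContinuousOn_of_continuous hw) ε hε
  obtain ⟨n, hn⟩ := exists_nat_one_div_lt hδ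
  have key : ∀ k : ℕ, k ≤ n + 1 → ∃ σ : ℝ → ℂ, ContinuousOn σ (Icc 0 (k / (n + 1))) ∧ σ 0 = a ∧
      ∀ s ∈ Icc (0 : ℝ) (k / (n + 1)), f.eval (σ s) = w s := by
    intro k
    induction k with
    | zero =>
      intro _
      refine ⟨fun _ => a, continuousOn_const, rfl, fun s hs => ?_⟩
      have : s = 0 := by simpa using hs
      rw [this, ha]
    | succ k ih =>
      intro hk
      obtain ⟨σ, hσ, hσ0, hσw⟩ := ih (by omega)
      have hn0 : (0 : ℝ) < n + 1 := by positivity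
      set S : ℝ := k / (n + 1) with hS
      have hS0 : 0 ≤ S := by positivity
      have hS1 : S ≤ 1 := by
        rw [hS, div_le_one hn0]; exact_mod_cast (by omega : k ≤ n + 1)
      have hSS : ((k + 1 : ℕ) : ℝ) / (n + 1) = S + 1 / (n + 1) := by
        rw [hS]; push_cast; ring
      have hT1 : S + 1 / (n + 1) ≤ 1 := by
        rw [← hSS, div_le_one hn0]; exact_mod_cast hk
      rw [hSS]
      have hfS : f.eval (σ S) = w S := hσw S ⟨hS0, le_rfl⟩
      obtain ⟨φ, hφ, hφw, hφS⟩ := hinv (σ S) ⟨hstay S ⟨hS0, hS1⟩ σ hσ hσ0 hσw,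
        ⟨S, ⟨hS0, hS1⟩, hfS.symm⟩⟩
      have hmaps : ∀ s ∈ Icc S (S + 1 / (n + 1)), w s ∈ Metric.ball (f.eval (σ S)) ε := by
        intro s hs
        rw [hfS]
        refine hunif s ⟨hS0.trans hs.1, hs.2.trans hT1⟩ S ⟨hS0, hS1⟩ ?_
        rw [Real.dist_eq, abs_of_nonneg (by linarith [hs.1])]
        linarith [hs.2]
      have hpos : 0 < (1 : ℝ) / (n + 1) := by positivity
      have e1 : EqOn (fun s => if s ≤ S then σ s else φ (w s)) σ (Icc 0 S) :=
        fun s hs => if_pos hs.2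
      have e2 : EqOn (fun s => if s ≤ S then σ s else φ (w s)) (fun s => φ (w s))
          (Icc S (S + 1 / (n + 1))) := by
        intro s hs
        by_cases h : s ≤ S
        · have : s = S := le_antisymm h hs.1
          simp only [this, le_refl, if_true]
          rw [← hfS, hφS]
        · exact if_neg h
      refine ⟨fun s => if s ≤ S then σ s else φ (w s), ?_, ?_, ?_⟩
      · rw [← Icc_union_Icc_eq_Icc hS0 (by linarith : S ≤ S + 1 / (n + 1))]
        refine ContinuousOn.union_of_isClosed (hσ.congr e1) (ContinuousOn.congr ?_ e2)
          isClosed_Icc isClosed_Icc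
        exact hφ.comp (hw.mono (Icc_subset_Icc hS0 hT1)) hmaps
      · simp only [hS0, if_true, hσ0]
      · intro s hs
        by_cases h : s ≤ S
        · simp only [h, if_true]; exact hσw s ⟨hs.1, h⟩
        · simp only [h, if_false]
          exact hφw _ (hmaps s ⟨(not_le.1 h).le, hs.2⟩)
  obtain ⟨σ, hσ, hσ0, hσw⟩ := key (n + 1) le_rfl
  have h1 : ((n + 1 : ℕ) : ℝ) / (n + 1) = 1 := by
    push_cast; exact div_self (by positivity)
  rw [h1] at hσ hσw
  exact ⟨σ, hσ, hσ0, hσw, fun s hs => hstay s hs σ (hσ.mono (Icc_subset_Icc_right hs.2)) hσ0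
    fun s' hs' => hσw s' ⟨hs'.1, hs'.2.trans hs.2⟩⟩

theorem isLocalHomeomorph_eval_noncritical (f : ℂ[X]) :
    IsLocalHomeomorph fun z : {z : ℂ // f.derivative.eval z ≠ 0} => f.eval (z : ℂ) := by
  have ho : IsOpen {z : ℂ | f.derivative.eval z ≠ 0} :=
    isOpen_ne_fun f.derivative.continuous continuous_const
  have h1 : IsLocalHomeomorphOn (fun z : ℂ => f.eval z) {z : ℂ | f.derivative.eval z ≠ 0} := by
    refine IsLocalHomeomorphOn.mk _ _ fun y hy => ?_
    obtain ⟨e, hye, he⟩ := exists_localHomeo f hy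
    exact ⟨e, hye, fun z _ => (he z).symm⟩
  rw [isLocalHomeomorph_iff_isLocalHomeomorphOn_univ]
  exact h1.comp (isLocalHomeomorph_iff_isLocalHomeomorphOn_univ.1
    ho.isOpenEmbedding_subtypeVal.isLocalHomeomorph) fun z _ => z.2

/-! ### Inverse branches on disks that reach the nearest critical value. -/

/-- The branch of the inverse of `f` on a disk whose radius is at most the distance to the critical
values on the surface. -/
theorem exists_inverse_branch {f : ℂ[X]} (hf : 0 < f.degree) {a : ℂ} {ρ : ℝ} (hρ : 0 < ρ)
    (h : ∀ c ∈ criticalPoints f, ENNReal.ofReal ρ ≤ surfaceDist f (fhat f a) (fhat f c)) :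
    ∃ g : ℂ → ℂ, ContinuousOn g (Metric.ball (f.eval a) ρ) ∧
      (∀ w ∈ Metric.ball (f.eval a) ρ, f.eval (g w) = w) ∧
      (∀ w ∈ Metric.ball (f.eval a) ρ, f.derivative.eval (g w) ≠ 0) ∧ g (f.eval a) = a := by
  have hseg : ∀ w : Metric.ball (f.eval a) ρ, ∃ σ : ℝ → ℂ, ContinuousOn σ (Icc 0 1) ∧ σ 0 = a ∧
      (∀ s ∈ Icc (0 : ℝ) 1, f.eval (σ s) = AffineMap.lineMap (f.eval a) (w : ℂ) s) ∧
      ∀ s ∈ Icc (0 : ℝ) 1, f.derivative.eval (σ s) ≠ 0 := by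
    intro w
    have hlip : LipschitzWith ‖(w : ℂ) - f.eval a‖₊
        (fun s : ℝ => (AffineMap.lineMap (f.eval a) (w : ℂ) s : ℂ)) := by
      refine LipschitzWith.of_dist_le_mul fun s t => ?_
      rw [dist_lineMap_lineMap, dist_comm (f.eval a), dist_eq_norm (w : ℂ), mul_comm]; rfl
    -- The confining set is a closed ball of the surface metric: a lift of part of the segment is no
    -- longer than the segment, and the critical points lie at distance at least ρ, hence outside.
    have hK : IsClosed {z | surfaceDist f (fhat f a) (fhat f z) ≤
        ENNReal.ofReal ‖(w : ℂ) - f.eval a‖} :=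
      isClosed_le (continuous_surfaceDist_right f _) continuous_const
    have hcrit : ∀ y ∈ {z | surfaceDist f (fhat f a) (fhat f z) ≤
        ENNReal.ofReal ‖(w : ℂ) - f.eval a‖}, f.derivative.eval y ≠ 0 := by
      intro y hy hy0
      have h1 := (h y hy0).trans hy
      rw [ENNReal.ofReal_le_ofReal_iff (norm_nonneg _)] at h1
      have h2 : dist (w : ℂ) (f.eval a) < ρ := w.2
      rw [dist_eq_norm] at h2
      linarith
    obtain ⟨σ, h1, h2, h3, h4⟩ := exists_lift hf
      (w := fun s : ℝ => (AffineMap.lineMap (f.eval a) (w : ℂ) s : ℂ))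
      hlip.continuous.continuousOn (a := a) (by simp) hK hcrit (by
        intro S hS σ hσ hσ0 hσw
        have h1 := surfaceDist_le_of_curve f hS.1 hσ
        rw [hσ0, eVariationOn.congr (g := fun s : ℝ =>
          (AffineMap.lineMap (f.eval a) (w : ℂ) s : ℂ)) fun s hs => hσw s hs] at h1
        refine (h1.trans (eVariationOn_le_of_lipschitzOnWith hS.1 hlip.lipschitzOnWith)).trans ?_
        calc (‖(w : ℂ) - f.eval a‖₊ : ℝ≥0∞) * ENNReal.ofReal S
            ≤ ‖(w : ℂ) - f.eval a‖₊ * 1 := by gcongr; simpa using hS.2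
          _ = ENNReal.ofReal ‖(w : ℂ) - f.eval a‖ := by
            rw [mul_one, ENNReal.ofReal, norm_toNNReal])
    exact ⟨σ, h1, h2, h3, fun s hs => hcrit _ (h4 s hs)⟩
  choose σ hσc hσ0 hσf hσn using hseg
  let G : unitInterval × Metric.ball (f.eval a) ρ → {z : ℂ // f.derivative.eval z ≠ 0} :=
    fun q => ⟨σ q.2 q.1, hσn q.2 q.1 q.1.2⟩
  -- The segments were lifted one at a time. Joint continuity holds because f is a local
  -- homeomorphism off its critical points and the lifts have a common starting point.
  have hG : Continuous G := by
    refine (isLocalHomeomorph_eval_noncritical f).continuous_lift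
      (T2Space.isSeparatedMap _)
      ⟨fun q => AffineMap.lineMap (f.eval a) ((q.2 : Metric.ball (f.eval a) ρ) : ℂ) (q.1 : ℝ), ?_⟩
      (funext fun q => hσf q.2 q.1 q.1.2) ?_ fun w => ?_
    · simp only [AffineMap.lineMap_apply_module]
      fun_prop
    · refine Continuous.subtype_mk ?_ _
      simp only [Icc.coe_zero, hσ0]
      exact continuous_const
    · exact Continuous.subtype_mk ((hσc w).comp_continuous continuous_subtype_val fun s => s.2) _
  classical
  have hval : ∀ w (hw : w ∈ Metric.ball (f.eval a) ρ),
      (if hw : w ∈ Metric.ball (f.eval a) ρ then σ ⟨w, hw⟩ 1 else 0) = σ ⟨w, hw⟩ 1 :=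
    fun w hw => dif_pos hw
  refine ⟨fun w => if hw : w ∈ Metric.ball (f.eval a) ρ then σ ⟨w, hw⟩ 1 else 0, ?_, ?_, ?_, ?_⟩
  · rw [continuousOn_iff_continuous_domRestrict]
    have : Continuous fun w : Metric.ball (f.eval a) ρ => ((G (1, w) : _) : ℂ) :=
      continuous_subtype_val.comp (hG.comp (by fun_prop))
    refine this.congr fun w => ?_
    simp only [domRestrict_apply, hval w w.2]
    rfl
  · intro w hw
    simp only [hval w hw]
    rw [hσf ⟨w, hw⟩ 1 (by simp)]
    simp
  · intro w hw
    simp only [hval w hw]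
    exact hσn ⟨w, hw⟩ 1 (by simp)
  · have ha := Metric.mem_ball_self (x := f.eval a) hρ
    simp only [hval _ ha]
    have := eqOn_of_eval_eq f (isPreconnected_Icc (a := (0 : ℝ)) (b := 1)) (hσc ⟨_, ha⟩)
      (g₂ := fun _ => a) continuousOn_const (hσn ⟨_, ha⟩)
      (fun s hs => by rw [hσf _ s hs]; simp) (left_mem_Icc.2 zero_le_one) (hσ0 _)
    exact this (right_mem_Icc.2 zero_le_one)

theorem edist_add_edist_le_eVariationOn {α E : Type*} [LinearOrder α] [PseudoEMetricSpace E]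
    (f : α → E) {x y z : α} (hxy : x ≤ y) (hyz : y ≤ z) :
    edist (f x) (f y) + edist (f y) (f z) ≤ eVariationOn f univ := by
  have h := eVariationOn.Icc_add_Icc f (s := univ) hxy hyz (mem_univ _)
  calc edist (f x) (f y) + edist (f y) (f z)
      ≤ eVariationOn f (univ ∩ Icc x y) + eVariationOn f (univ ∩ Icc y z) :=
        add_le_add (eVariationOn.edist_le f ⟨mem_univ _, left_mem_Icc.2 hxy⟩
          ⟨mem_univ _, right_mem_Icc.2 hxy⟩)
          (eVariationOn.edist_le f ⟨mem_univ _, left_mem_Icc.2 hyz⟩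
          ⟨mem_univ _, right_mem_Icc.2 hyz⟩)
    _ = eVariationOn f (univ ∩ Icc x z) := h
    _ ≤ eVariationOn f univ := eVariationOn.mono f inter_subset_left

theorem ofReal_norm_sub_le_surfaceDist (f : ℂ[X]) (a c : ℂ) :
    ENNReal.ofReal ‖f.eval a - f.eval c‖ ≤ surfaceDist f (fhat f a) (fhat f c) := by
  refine le_iInf fun γ => ?_
  have h := eVariationOn.edist_le (fun s : unitInterval => proj f (γ s)) (mem_univ 0) (mem_univ 1)
  simpa [proj_fhat, pathLength, edist_dist, dist_eq_norm] using h

/-- A path of length almost `R` that leaves the disk of a branch of the inverse follows the branch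
nearly up to the boundary of the disk, and is short afterwards. -/
theorem exists_exit_time {f : ℂ[X]} {a c : ℂ} (hc : c ∈ criticalPoints f) {R : ℝ}
    (hR : surfaceDist f (fhat f a) (fhat f c) = ENNReal.ofReal R) {g : ℂ → ℂ}
    (hg : ContinuousOn g (Metric.ball (f.eval a) R))
    (hgf : ∀ w ∈ Metric.ball (f.eval a) R, f.eval (g w) = w)
    (hgn : ∀ w ∈ Metric.ball (f.eval a) R, f.derivative.eval (g w) ≠ 0)
    (hga : g (f.eval a) = a) {ε : ℝ} (hε : 0 < ε) (hεR : ε < R) :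
    ∃ w ∈ Metric.ball (f.eval a) R, ‖w - f.eval a‖ = R - ε ∧ ‖w - f.eval c‖ ≤ 2 * ε ∧
      ∃ S : Set ℂ, IsPreconnected S ∧ g w ∈ S ∧ c ∈ S ∧ ∀ z ∈ S, ‖f.eval z - f.eval c‖ ≤ 4 * ε := by
  have hlt : surfaceDist f (fhat f a) (fhat f c) < ENNReal.ofReal (R + ε) := by
    rw [hR]; exact (ENNReal.ofReal_lt_ofReal_iff (by linarith)).2 (by linarith)
  obtain ⟨γ, hγ⟩ := iInf_lt_iff.1 hlt
  set q : unitInterval → ℂ := fun s => coord f (γ s) with hq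
  have hqc : Continuous q := (continuous_coord f).comp γ.continuous
  have hq0 : q 0 = a := by simp [hq, coord_fhat]
  have hq1 : q 1 = c := by simp [hq, coord_fhat]
  have hWc : Continuous fun s => ‖f.eval (q s) - f.eval a‖ := by fun_prop
  -- Two consecutive chords are bounded by the total length, so a path already far from f a has
  -- little length left.
  have hvar : ∀ s t : unitInterval, s ≤ t →
      ‖f.eval (q s) - f.eval a‖ + ‖f.eval (q t) - f.eval (q s)‖ ≤ R + ε := by
    intro s t hst
    have h := (edist_add_edist_le_eVariationOn (fun s : unitInterval => proj f (γ s))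
      (unitInterval.nonneg' (t := s)) hst).trans hγ.le
    simp only [proj_eq_eval_coord, edist_dist] at h
    rw [← ENNReal.ofReal_add dist_nonneg dist_nonneg, ENNReal.ofReal_le_ofReal_iff (by linarith),
      dist_comm, dist_comm (f.eval (coord f (γ s))) (f.eval (coord f (γ t))), γ.source, coord_fhat] at h
    simpa only [dist_eq_norm] using h
  have hfollow : ∀ τ : unitInterval, (∀ s ≤ τ, ‖f.eval (q s) - f.eval a‖ < R) →
      q τ = g (f.eval (q τ)) := by
    intro τ hτ
    have hm : ∀ s ∈ Iic τ, f.eval (q s) ∈ Metric.ball (f.eval a) R := fun s hs => by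
      rw [Metric.mem_ball, dist_eq_norm]; exact hτ s hs
    have := eqOn_of_eval_eq f (S := Iic τ) isPreconnected_Iic (g₁ := fun s => g (f.eval (q s)))
      (g₂ := q) (hg.comp (by fun_prop) hm) hqc.continuousOn (fun s hs => hgn _ (hm s hs))
      (fun s hs => hgf _ (hm s hs)) (x₀ := 0) unitInterval.nonneg'
      (by simp only [hq0, hga])
    exact (this (mem_Iic.2 le_rfl)).symm
  -- A path that never came this far out would follow the branch up to its end c, but the branch
  -- takes no critical value of z.
  have hne : {s | R - ε ≤ ‖f.eval (q s) - f.eval a‖}.Nonempty := by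
    by_contra hcon
    rw [not_nonempty_iff_eq_empty, eq_empty_iff_forall_notMem] at hcon
    have hlt : ∀ s, ‖f.eval (q s) - f.eval a‖ < R := fun s => by
      have : ‖f.eval (q s) - f.eval a‖ < R - ε := not_le.1 (hcon s)
      linarith
    have h1 := hfollow 1 fun s _ => hlt s
    have h2 := hgn (f.eval (q 1)) (by rw [Metric.mem_ball, dist_eq_norm]; exact hlt 1)
    rw [← h1, hq1] at h2
    exact h2 hc
  obtain ⟨τ, hτ, hmin⟩ :=
    (isClosed_le continuous_const hWc :
      IsClosed {s | R - ε ≤ ‖f.eval (q s) - f.eval a‖}).isCompact.exists_isLeast hne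
  have hτ : R - ε ≤ ‖f.eval (q τ) - f.eval a‖ := hτ
  have hmin : ∀ s, R - ε ≤ ‖f.eval (q s) - f.eval a‖ → τ ≤ s := fun s hs => hmin hs
  have hτeq : ‖f.eval (q τ) - f.eval a‖ = R - ε := by
    obtain ⟨s, hs, hs'⟩ := intermediate_value_Icc (unitInterval.nonneg' (t := τ))
      hWc.continuousOn (show R - ε ∈ Icc _ _ from ⟨by simp [hq0]; linarith, hτ⟩)
    rw [← le_antisymm hs.2 (hmin s hs'.ge)]
    exact hs'
  have hafter : ∀ s, τ ≤ s → ‖f.eval (q s) - f.eval (q τ)‖ ≤ 2 * ε := fun s hs => by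
    have := hvar τ s hs
    linarith
  have hτ1 := hafter 1 unitInterval.le_one'
  rw [hq1, norm_sub_rev] at hτ1
  have hqτ : q τ = g (f.eval (q τ)) := by
    refine hfollow τ fun s hs => ?_
    by_contra hcon
    have h1 := hmin s (by linarith)
    rw [le_antisymm hs h1, hτeq] at hcon
    linarith
  refine ⟨f.eval (q τ), ?_, hτeq, hτ1, q '' Icc τ 1, ?_, ?_, ?_, ?_⟩
  · rw [Metric.mem_ball, dist_eq_norm]; linarith
  · exact isPreconnected_Icc.image _ hqc.continuousOn
  · rw [← hqτ]; exact ⟨τ, left_mem_Icc.2 unitInterval.le_one', rfl⟩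
  · exact ⟨1, right_mem_Icc.2 unitInterval.le_one', hq1⟩
  · rintro _ ⟨s, hs, rfl⟩
    have h1 := hafter s hs.1
    calc ‖f.eval (q s) - f.eval c‖
        ≤ ‖f.eval (q s) - f.eval (q τ)‖ + ‖f.eval (q τ) - f.eval c‖ := norm_sub_le_norm_sub_add_norm_sub ..
      _ ≤ 4 * ε := by linarith

/-- At a point of the Voronoi domain of a critical value, the branch of the inverse of `f` is
defined on the disk up to that critical value, and converges there to the critical point. -/
theorem exists_branch_of_mem_voronoi {f : ℂ[X]} (hf : 0 < f.degree) {a c : ℂ}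
    (hc : c ∈ criticalPoints f) (ha : fhat f a ∈ voronoi f (fhat f c))
    (hne : f.eval a ≠ f.eval c) :
    ∃ g : ℂ → ℂ, ContinuousOn g (Metric.ball (f.eval a) ‖f.eval a - f.eval c‖) ∧
      (∀ w ∈ Metric.ball (f.eval a) ‖f.eval a - f.eval c‖, f.eval (g w) = w) ∧
      (∀ w ∈ Metric.ball (f.eval a) ‖f.eval a - f.eval c‖, f.derivative.eval (g w) ≠ 0) ∧
      g (f.eval a) = a ∧
      Tendsto g (𝓝[Metric.ball (f.eval a) ‖f.eval a - f.eval c‖] (f.eval c)) (𝓝 c) := by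
  have hf' : f.derivative ≠ 0 := by
    intro h
    rw [derivative_eq_zero, natDegree_eq_zero_iff_degree_le_zero] at h
    exact absurd hf (not_lt.2 h)
  obtain ⟨R, hR0, hR⟩ : ∃ R : ℝ, 0 ≤ R ∧
      surfaceDist f (fhat f a) (fhat f c) = ENNReal.ofReal R :=
    ⟨_, ENNReal.toReal_nonneg, (ENNReal.ofReal_toReal (surfaceDist_ne_top f a c)).symm⟩
  have hle : ‖f.eval a - f.eval c‖ ≤ R := by
    have := ofReal_norm_sub_le_surfaceDist f a c
    rwa [hR, ENNReal.ofReal_le_ofReal_iff hR0] at this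
  have hRpos : 0 < R := (norm_pos_iff.2 (sub_ne_zero.2 hne)).trans_le hle
  obtain ⟨g, hg, hgf, hgn, hga⟩ := exists_inverse_branch hf hRpos fun c' hc' => by
    rw [← hR]; exact ha _ ⟨c', hc', rfl⟩
  have hexit := fun ε h0 h1 => exists_exit_time hc hR hg hgf hgn hga (ε := ε) h0 h1
  -- Exit points lie at distance R - ε from f a and within 2ε of f c, so R exceeds the Euclidean
  -- distance by at most 3ε.
  have hge : R ≤ ‖f.eval a - f.eval c‖ := by
    refine le_of_forall_pos_le_add fun e he => ?_
    obtain ⟨w, -, h1, h2, -⟩ := hexit (min (e / 3) (R / 2)) (by positivity)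
      ((min_le_right _ _).trans_lt (by linarith))
    have h3 := norm_sub_le_norm_sub_add_norm_sub w (f.eval c) (f.eval a)
    rw [norm_sub_rev (f.eval c)] at h3
    have := min_le_left (e / 3) (R / 2)
    linarith
  rw [le_antisymm hle hge]
  refine ⟨g, hg, hgf, hgn, hga, Metric.tendsto_nhds.2 fun η hη => ?_⟩
  -- The trap is used twice. At scale η' it keeps the tail of a nearly shortest path, hence its exit
  -- point g w, close to c. At scale η it then keeps close to c the image under g of the part of the
  -- disk within δ of f c, which is connected because that part is convex.
  obtain ⟨δ, hδ, η', hη', htrap⟩ := exists_trap hf' c hη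
  obtain ⟨δ₂, hδ₂, η₂, hη₂, htrap₂⟩ := exists_trap hf' c hη'
  obtain ⟨ε, hε, hεR, hεδ, hεδ₂⟩ : ∃ ε > 0, ε < R ∧ 4 * ε < δ ∧ 4 * ε < δ₂ := by
    refine ⟨min (R / 2) (min (δ / 8) (δ₂ / 8)), by positivity, ?_, ?_, ?_⟩
    · exact (min_le_left _ _).trans_lt (by linarith)
    · have := (min_le_right (R / 2) (min (δ / 8) (δ₂ / 8))).trans (min_le_left _ _)
      linarith
    · have := (min_le_right (R / 2) (min (δ / 8) (δ₂ / 8))).trans (min_le_right _ _)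
      linarith
  obtain ⟨w, hw, -, hwc, S, hS, hwS, hcS, hSf⟩ := hexit ε hε hεR
  have hgw : g w ∈ Metric.ball c η' := htrap₂ S hS ⟨c, hcS, Metric.mem_ball_self hη₂⟩
    (fun z hz => (hSf z hz).trans_lt hεδ₂) hwS
  have hsub := htrap (g '' (Metric.ball (f.eval a) R ∩ Metric.ball (f.eval c) δ))
    (((convex_ball _ _).inter (convex_ball _ _)).isPreconnected.image _ (hg.mono inter_subset_left))
    ⟨g w, ⟨w, ⟨hw, by rw [Metric.mem_ball, dist_eq_norm]; linarith⟩, rfl⟩, hgw⟩ (by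
      rintro _ ⟨w', hw', rfl⟩
      rw [hgf w' hw'.1, ← dist_eq_norm]
      exact hw'.2)
  filter_upwards [self_mem_nhdsWithin, mem_nhdsWithin_of_mem_nhds (Metric.ball_mem_nhds _ hδ)]
    with w' h1 h2
  exact hsub ⟨w', ⟨h1, h2⟩, rfl⟩

/-! ### Lifted rays, perpendiculars to them, and growth of the modulus. -/

/-- The ray from `0` through `f z` carries no critical value. -/
def RegularRay (f : ℂ[X]) (z : ℂ) : Prop :=
  ∀ c ∈ criticalPoints f, ∀ s : ℝ, 0 ≤ s → (s : ℂ) * f.eval z ≠ f.eval c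

/-- `Λ` is the lift through `z` of the ray from `0` through `f z`, extended by a constant to
negative parameters. -/
def IsRayLift (f : ℂ[X]) (z : ℂ) (Λ : ℝ → ℂ) : Prop :=
  Continuous Λ ∧ Λ 1 = z ∧ ∀ s, f.eval (Λ s) = ((max s 0 : ℝ) : ℂ) * f.eval z

/-- Off the critical values f is a covering, and a regular ray, including its origin, stays there;
so it lifts in full through z. -/
theorem RegularRay.exists_isRayLift {f : ℂ[X]} {z : ℂ} (hz : RegularRay f z) :
    ∃ Λ, IsRayLift f z Λ := by
  obtain ⟨Λ, ⟨h1, h2⟩, -⟩ := f.isCoveringMapOn_eval.existsUnique_continuousMap_lifts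
    (⟨fun s : ℝ => ((max s 0 : ℝ) : ℂ) * f.eval z, by fun_prop⟩ : C(ℝ, ℂ)) (a₀ := 1) (e₀ := z)
    (by simp) (by
      rintro s ⟨c, hc, hcs⟩
      exact hz c hc (max s 0) (le_max_right _ _) hcs.symm)
  exact ⟨Λ, Λ.continuous, h1, fun s => congrFun h2 s⟩

theorem IsRayLift.eval_eq {f : ℂ[X]} {z : ℂ} {Λ : ℝ → ℂ} (h : IsRayLift f z Λ) {s : ℝ}
    (hs : 0 ≤ s) : f.eval (Λ s) = (s : ℂ) * f.eval z := by
  rw [h.2.2, max_eq_left hs]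

theorem IsRayLift.derivative_ne_zero {f : ℂ[X]} {z : ℂ} {Λ : ℝ → ℂ} (h : IsRayLift f z Λ)
    (hz : RegularRay f z) (s : ℝ) : f.derivative.eval (Λ s) ≠ 0 := fun h0 =>
  hz (Λ s) h0 (max s 0) (le_max_right _ _) (h.2.2 s).symm

/-- If `c` influences the orbit of `z` at an acute angle, then the perpendicular from `f c` to
the ray through `f z` lifts to a curve from `c` to the lifted ray. -/
theorem exists_perpendicular_lift {f : ℂ[X]} (hf : 0 < f.degree) {c z : ℂ}
    (hc : c ∈ criticalPoints f) (hz : RegularRay f z) {Λ : ℝ → ℂ} (hΛ : IsRayLift f z Λ)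
    (hinf : Influences f c z) (hre : 0 < (f.eval c / f.eval z).re) :
    ∃ σ : ℝ → ℂ, ContinuousOn σ (Ioc 0 1) ∧
      (∀ s ∈ Ioc (0 : ℝ) 1, f.eval (σ s) =
        f.eval c + s * (((f.eval c / f.eval z).re : ℂ) * f.eval z - f.eval c)) ∧
      (∀ s ∈ Ioc (0 : ℝ) 1, f.derivative.eval (σ s) ≠ 0) ∧
      Tendsto σ (𝓝[>] 0) (𝓝 c) ∧ σ 1 = Λ (f.eval c / f.eval z).re := by
  have hz0 : f.eval z ≠ 0 := by
    intro h
    simp [h] at hre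
  obtain ⟨o, ho, p, ⟨γ, hγ, s₀, rfl⟩, hvor⟩ := hinf
  have hγe : ∀ s : unitInterval, f.eval (coord f (γ s)) = (s : ℝ) * f.eval z := by
    intro s
    rw [← proj_eq_eval_coord, hγ, ho, proj_fhat, AffineMap.lineMap_apply_module]
    simp
  -- Uniqueness of lifts is anchored at the endpoint z: the preimage of 0 at which the lift starts
  -- is not known in advance.
  have hγΛ : ∀ s : unitInterval, Λ s = coord f (γ s) := by
    intro s
    refine eqOn_of_eval_eq f (S := univ) (g₁ := fun s : unitInterval => Λ s)
      (g₂ := fun s => coord f (γ s)) isPreconnected_univ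
      (hΛ.1.comp continuous_subtype_val).continuousOn
      ((continuous_coord f).comp γ.continuous).continuousOn
      (fun s _ => hΛ.derivative_ne_zero hz s) (fun s _ => ?_) (mem_univ 1) ?_ (mem_univ s)
    · rw [hγe, hΛ.eval_eq s.2.1]
    · simp [hΛ.2.1, coord_fhat]
  set a := Λ s₀ with ha
  have hfa : f.eval a = ((s₀ : ℝ) : ℂ) * f.eval z := hΛ.eval_eq s₀.2.1
  have hvor' : fhat f a ∈ voronoi f (fhat f c) := by
    rw [ha, hγΛ, fhat_coord]; exact hvor
  obtain ⟨g, hg, hgf, hgn, hga, hgc⟩ := exists_branch_of_mem_voronoi hf hc hvor'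
    (by rw [hfa]; exact hz c hc _ s₀.2.1)
  -- In the target plane with f z as unit, f a is the real number s₀, f c is u, and the foot of the
  -- perpendicular is Re u. Regularity of the ray gives Im u ≠ 0, which makes the disk inequalities
  -- strict.
  set u := f.eval c / f.eval z with hu
  have huz : f.eval c = u * f.eval z := by rw [hu, div_mul_cancel₀ _ hz0]
  have him : u.im ≠ 0 := by
    intro h
    refine hz c hc u.re hre.le ?_
    rw [huz]; congr 1
    exact Complex.ext rfl (by simp [h])
  have hball : ∀ v : ℂ, (v - (s₀ : ℝ)).re ^ 2 + (v - (s₀ : ℝ)).im ^ 2 <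
      (u.re - s₀) ^ 2 + u.im ^ 2 →
      v * f.eval z ∈ Metric.ball (f.eval a) ‖f.eval a - f.eval c‖ := by
    intro v hv
    rw [Metric.mem_ball, dist_eq_norm, hfa, huz, ← sub_mul, ← sub_mul, norm_mul, norm_mul]
    refine mul_lt_mul_of_pos_right ?_ (norm_pos_iff.2 hz0)
    rw [norm_sub_rev _ u, ← sq_lt_sq₀ (norm_nonneg _) (norm_nonneg _), Complex.sq_norm,
      Complex.sq_norm, Complex.normSq_apply, Complex.normSq_apply]
    simp only [Complex.sub_re, Complex.sub_im, Complex.ofReal_re, Complex.ofReal_im] at hv ⊢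
    nlinarith
  have him2 : 0 < u.im ^ 2 := by positivity
  have hperp : ∀ s ∈ Ioc (0 : ℝ) 1, f.eval c + s * ((u.re : ℂ) * f.eval z - f.eval c) ∈
      Metric.ball (f.eval a) ‖f.eval a - f.eval c‖ := by
    intro s hs
    have h1 := hball (u + s * (u.re - u)) (by
      simp only [Complex.add_re, Complex.sub_re, Complex.mul_re, Complex.ofReal_re,
        Complex.ofReal_im, Complex.add_im, Complex.sub_im, Complex.mul_im]
      have : (1 - s) ^ 2 * u.im ^ 2 < 1 * u.im ^ 2 :=
        mul_lt_mul_of_pos_right (by nlinarith [hs.1, hs.2]) him2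
      nlinarith)
    convert h1 using 1
    rw [huz]
    ring
  refine ⟨fun s => g (f.eval c + s * ((u.re : ℂ) * f.eval z - f.eval c)),
    hg.comp (by fun_prop) hperp, fun s hs => hgf _ (hperp s hs), fun s hs => hgn _ (hperp s hs),
    hgc.comp ?_, ?_⟩
  · refine tendsto_nhdsWithin_iff.2 ⟨?_, ?_⟩
    · have : Continuous fun s : ℝ => f.eval c + s * ((u.re : ℂ) * f.eval z - f.eval c) := by
        fun_prop
      have h := (this.tendsto 0).mono_left (nhdsWithin_le_nhds (s := Ioi 0))
      simpa using h
    · filter_upwards [Ioc_mem_nhdsGT (zero_lt_one' ℝ)] with s hs using hperp s hs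
  · have hfoot : ((u.re : ℝ) : ℂ) * f.eval z ∈
        Metric.ball (f.eval a) ‖f.eval a - f.eval c‖ := by simpa using hperp 1 (by simp)
    -- The ray meets the disk in a convex set containing both f a and the foot, so Λ and g, which
    -- agree over f a, agree over the foot.
    have hconv : IsPreconnected (Ici (0 : ℝ) ∩ {s : ℝ | (s : ℂ) * f.eval z ∈
        Metric.ball (f.eval a) ‖f.eval a - f.eval c‖}) := by
      refine ((convex_Ici (0 : ℝ)).inter ?_).isPreconnected
      refine (convex_ball (f.eval a) ‖f.eval a - f.eval c‖).is_linear_preimage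
        (f := fun s : ℝ => (s : ℂ) * f.eval z) ⟨fun x y => ?_, fun x y => ?_⟩
      · push_cast; ring
      · simp [mul_assoc]
    have hin : f.eval a ∈ Metric.ball (f.eval a) ‖f.eval a - f.eval c‖ :=
      Metric.mem_ball_self (norm_pos_iff.2 (sub_ne_zero.2
        (by rw [hfa]; exact hz c hc _ s₀.2.1)))
    have := eqOn_of_eval_eq f hconv (g₁ := Λ) (g₂ := fun s : ℝ => g (s * f.eval z))
      hΛ.1.continuousOn (hg.comp (by fun_prop) fun s hs => hs.2)
      (fun s _ => hΛ.derivative_ne_zero hz s)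
      (fun s hs => by rw [hΛ.eval_eq hs.1, hgf _ hs.2])
      (x₀ := (s₀ : ℝ)) ⟨s₀.2.1, by rw [mem_ofPred_eq, ← hfa]; exact hin⟩
      (show Λ s₀ = g (s₀ * f.eval z) by rw [← hfa, hga])
    simpa using (this ⟨hre.le, hfoot⟩).symm

theorem IsRayLift.hasDerivAt {f : ℂ[X]} {z : ℂ} {Λ : ℝ → ℂ} (h : IsRayLift f z Λ)
    (hz : RegularRay f z) {s : ℝ} (hs : 0 < s) :
    HasDerivAt Λ (f.eval z / f.derivative.eval (Λ s)) s := by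
  obtain ⟨e, hes, he⟩ := exists_localHomeo f (h.derivative_ne_zero hz s)
  have hline : HasDerivAt (fun t : ℝ => (t : ℂ) * f.eval z) (f.eval z) s := by
    simpa using (Complex.ofRealCLM.hasDerivAt (x := s)).mul_const (f.eval z)
  have hes' : e (Λ s) = (s : ℂ) * f.eval z := by rw [he, h.eval_eq hs.le]
  have hsymm : HasDerivAt e.symm (f.derivative.eval (Λ s))⁻¹ ((s : ℂ) * f.eval z) := by
    rw [← hes']
    refine e.hasDerivAt_symm (e.map_source hes) (h.derivative_ne_zero hz s) ?_
    rw [e.left_inv hes, show (e : ℂ → ℂ) = fun x => f.eval x from funext he]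
    exact f.hasDerivAt _
  have hcomp := hsymm.comp s hline
  rw [div_eq_inv_mul]
  refine hcomp.congr_of_eventuallyEq ?_
  filter_upwards [h.1.continuousAt.preimage_mem_nhds (e.open_source.mem_nhds hes),
    lt_mem_nhds hs] with t ht ht0
  rw [Function.comp, ← h.eval_eq ht0.le, ← he, e.left_inv ht]

/-- Where `z f'(z) / f z` has positive real part outside the unit disk, the modulus increases along
the lift of a ray. -/
theorem IsRayLift.norm_lt_norm {f : ℂ[X]}
    (hpos : ∀ z : ℂ, 1 ≤ ‖z‖ → 0 < (z * f.derivative.eval z / f.eval z).re) {z : ℂ} {Λ : ℝ → ℂ}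
    (h : IsRayLift f z Λ) (hz : RegularRay f z) {s₁ s₂ : ℝ} (h₁ : 0 < s₁) (h₁₂ : s₁ < s₂)
    (hn : 1 ≤ ‖Λ s₁‖) : ‖Λ s₁‖ < ‖Λ s₂‖ := by
  -- With q = Λ f'(Λ) / f(Λ), the derivative of |Λ|² at m is (2 / m) |Λ|² Re(1 / q), which has the
  -- sign of Re q.
  have hincr : ∀ m ∈ Ico s₁ s₂, 1 ≤ ‖Λ m‖ → ∃ s ∈ Icc s₁ s₂, ‖Λ m‖ < ‖Λ s‖ := by
    intro m hm hm1
    have hm0 : 0 < m := h₁.trans_le hm.1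
    have hd := (h.hasDerivAt hz hm0).norm_sq
    set D := 2 * inner ℝ (Λ m) (f.eval z / f.derivative.eval (Λ m)) with hD
    have hDpos : 0 < D := by
      have hq := hpos (Λ m) hm1
      have hfn : f.derivative.eval (Λ m) ≠ 0 := h.derivative_ne_zero hz m
      have hm0' : (m : ℂ) ≠ 0 := by exact_mod_cast hm0.ne'
      have hw : Λ m ≠ 0 := norm_pos_iff.1 (by linarith)
      have hf0 : f.eval (Λ m) ≠ 0 := fun h0 => by simp [h0] at hq
      have hfz : f.eval z = f.eval (Λ m) / m := by
        rw [h.eval_eq hm0.le]; field_simp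
      set q := Λ m * f.derivative.eval (Λ m) / f.eval (Λ m) with hqdef
      have hq0 : q ≠ 0 := fun h0 => by simp [h0] at hq
      have : f.eval z / f.derivative.eval (Λ m) = ((1 / m : ℝ) : ℂ) * (Λ m * q⁻¹) := by
        rw [hfz, hqdef]; push_cast; field_simp
      rw [hD, this, Complex.inner]
      have e1 : conj (Λ m) * (((1 / m : ℝ) : ℂ) * (Λ m * q⁻¹)) =
          ((1 / m * Complex.normSq (Λ m) : ℝ) : ℂ) * q⁻¹ := by
        push_cast
        rw [Complex.normSq_eq_conj_mul_self]; ring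
      have e2 : (((1 / m : ℝ) : ℂ) * (Λ m * q⁻¹)) * conj (Λ m) =
          ((1 / m * Complex.normSq (Λ m) : ℝ) : ℂ) * q⁻¹ := by
        rw [mul_comm, e1]
      rw [e2]
      rw [Complex.re_ofReal_mul, Complex.inv_re]
      have := Complex.normSq_pos.2 hw
      have := Complex.normSq_pos.2 hq0
      positivity
    have hslope := (hasDerivAt_iff_tendsto_slope.1 hd).eventually_const_lt hDpos
    have hslope' := hslope.filter_mono
      (nhdsWithin_mono m (fun x (hx : x ∈ Ioi m) => (ne_of_gt hx : x ≠ m)))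
    obtain ⟨s, hs, hs'⟩ := (hslope'.and (Ioc_mem_nhdsGT hm.2)).exists
    refine ⟨s, ⟨hm.1.trans hs'.1.le, hs'.2⟩, ?_⟩
    rw [slope_def_field] at hs
    have := (div_pos_iff_of_pos_right (sub_pos.2 hs'.1)).1 hs
    exact lt_of_pow_lt_pow_left₀ 2 (norm_nonneg _) (sub_pos.1 this)
  -- A maximum of the modulus before s₂ would still have modulus at least 1, so `hincr` would exceed
  -- it.
  obtain ⟨m, hm, hmax⟩ := isCompact_Icc.exists_isMaxOn (nonempty_Icc.2 h₁₂.le)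
    (h.1.norm.continuousOn (s := Icc s₁ s₂))
  have hm1 : ‖Λ s₁‖ ≤ ‖Λ m‖ := hmax (left_mem_Icc.2 h₁₂.le)
  have hms : m = s₂ := by
    by_contra hne
    obtain ⟨s, hs, hlt⟩ := hincr m ⟨hm.1, lt_of_le_of_ne hm.2 hne⟩ (hn.trans hm1)
    exact (hmax hs).not_gt hlt
  obtain ⟨s, hs, hlt⟩ := hincr s₁ ⟨le_rfl, h₁₂⟩ hn
  rw [← hms]
  exact hlt.trans_le (hmax hs)

/-! ### Counting the influenced points over one ray. -/

/-- Write f - f c = (z - c)^N q with q(c) ≠ 0. Then φ = (z - c) (q / q(c))^{1/N} has derivative 1 at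
c, so it is injective nearby, and b = 1 / q(c). -/
theorem exists_local_root {f : ℂ[X]} (hf : f.derivative ≠ 0) {c : ℂ} :
    ∃ φ : ℂ → ℂ, ∃ U ∈ 𝓝 c, InjOn φ U ∧ ∃ b : ℂ, ∀ z ∈ U,
      φ z ^ (f.derivative.rootMultiplicity c + 1) = b * (f.eval z - f.eval c) := by
  set P := f - C (f.eval c) with hP
  have hPd : derivative P = derivative f := by simp [hP]
  have hP0 : P ≠ 0 := fun h => hf (by rw [← hPd, h, derivative_zero])
  have hroot : P.IsRoot c := by simp [hP]
  have hN : f.derivative.rootMultiplicity c + 1 = P.rootMultiplicity c := by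
    rw [← hPd, derivative_rootMultiplicity_of_root hroot]
    have := (rootMultiplicity_pos hP0).2 hroot
    omega
  rw [hN]
  set N := P.rootMultiplicity c with hNdef
  have hN0 : N ≠ 0 := by omega
  set q := P /ₘ (X - C c) ^ N with hq
  have hfac : (X - C c) ^ N * q = P := pow_mul_divByMonic_rootMultiplicity_eq P c
  have hqc : q.eval c ≠ 0 := eval_divByMonic_pow_rootMultiplicity_ne_zero c hP0
  have hslit : q.eval c / q.eval c ∈ Complex.slitPlane := by
    rw [div_self hqc]; exact Complex.one_mem_slitPlane
  have hh : HasStrictDerivAt (fun z => Complex.exp (Complex.log (q.eval z / q.eval c) / N)) _ c :=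
    (((q.hasStrictDerivAt c).div_const (q.eval c)).clog hslit |>.div_const (N : ℂ)).cexp
  have hid : HasStrictDerivAt (fun z : ℂ => id z - c) 1 c := (hasStrictDerivAt_id c).sub_const c
  have hφ := HasStrictDerivAt.fun_mul hid hh
  have hone : Complex.exp (Complex.log (q.eval c / q.eval c) / N) = 1 := by
    rw [div_self hqc]; simp
  simp only [id, sub_self, zero_mul, add_zero, one_mul, hone] at hφ
  refine ⟨fun z => (z - c) * Complex.exp (Complex.log (q.eval z / q.eval c) / N),
    ((hφ.hasStrictFDerivAt_equiv one_ne_zero).toOpenPartialHomeomorph _).source ∩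
      {z | q.eval z / q.eval c ≠ 0}, ?_, ?_, (q.eval c)⁻¹, ?_⟩
  · refine inter_mem (((hφ.hasStrictFDerivAt_equiv one_ne_zero).toOpenPartialHomeomorph
      _).open_source.mem_nhds
      (hφ.hasStrictFDerivAt_equiv one_ne_zero).mem_toOpenPartialHomeomorph_source) ?_
    refine IsOpen.mem_nhds (isOpen_ne_fun (by fun_prop) continuous_const) ?_
    simp [hqc]
  · exact ((hφ.hasStrictFDerivAt_equiv one_ne_zero).toOpenPartialHomeomorph _).injOn.mono
      inter_subset_left
  · intro z hz
    rw [mul_pow, ← Complex.exp_nat_mul, mul_div_cancel₀ _ (by exact_mod_cast hN0),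
      Complex.exp_log hz.2]
    have := congrArg (eval z) hfac
    simp only [eval_mul, eval_pow, eval_sub, eval_X, eval_C, hP] at this
    rw [← this]; ring

/-- The number of disjoint lifts of a curve that issue from a critical point is at most its order
as a zero of `f - f c`. -/
theorem card_le_of_tendsto {f : ℂ[X]} (hf : f.derivative ≠ 0) {c : ℂ} {ι α : Type*} (F : Finset ι)
    {l : Filter α} [l.NeBot] {σ : ι → α → ℂ} (hσ : ∀ i ∈ F, Tendsto (σ i) l (𝓝 c))
    (hne : ∀ᶠ s in l, ∀ i ∈ F, ∀ j ∈ F, σ i s = σ j s → i = j) {w : α → ℂ}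
    (hw : ∀ᶠ s in l, ∀ i ∈ F, f.eval (σ i s) = w s) :
    F.card ≤ f.derivative.rootMultiplicity c + 1 := by
  classical
  obtain ⟨φ, U, hU, hinj, b, hφ⟩ := exists_local_root hf (c := c)
  have hmem : ∀ᶠ s in l, ∀ i ∈ F, σ i s ∈ U :=
    (Finset.eventually_all F).2 fun i hi => hσ i hi hU
  -- One parameter s suffices: the local coordinate φ sends the points σ i s to distinct N-th roots
  -- of a single number.
  obtain ⟨s, h1, h2, h3⟩ := (hne.and (hw.and hmem)).exists
  set N := f.derivative.rootMultiplicity c + 1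
  have hcard : F.card ≤ (nthRoots N (b * (w s - f.eval c))).toFinset.card := by
    refine Finset.card_le_card_of_injOn (fun i => φ (σ i s)) (fun i hi => ?_) fun i hi j hj hij => ?_
    · simp only [Finset.mem_coe, Multiset.mem_toFinset]
      rw [mem_nthRoots (Nat.succ_pos _), hφ _ (h3 i hi), h2 i hi]
    · exact h1 i hi j hj (hinj (h3 i hi) (h3 j hj) hij)
  exact hcard.trans ((Multiset.toFinset_card_le _).trans (card_nthRoots _ _))

/-- All z in F share one ray, hence one perpendicular from f c, and each z contributes a lift of it
issuing from c. These lifts are pairwise disjoint, so the local degree of f at c bounds their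
number. -/
theorem card_influenced_le {f : ℂ[X]} (hf : 0 < f.degree)
    (hpos : ∀ z : ℂ, 1 ≤ ‖z‖ → 0 < (z * f.derivative.eval z / f.eval z).re) {c : ℂ}
    (hc : c ∈ criticalPoints f) {r : ℝ} (hr : 1 ≤ r) (F : Finset ℂ)
    (hF : ∀ z ∈ F, ‖z‖ = r ∧ RegularRay f z ∧ Influences f c z ∧ 0 < (f.eval c / f.eval z).re)
    (hray : ∀ z ∈ F, ∀ z' ∈ F, ∃ κ : ℝ, 0 < κ ∧ f.eval z' = κ * f.eval z) :
    F.card ≤ f.derivative.rootMultiplicity c + 1 := by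
  have hf' : f.derivative ≠ 0 := by
    intro h
    rw [derivative_eq_zero, natDegree_eq_zero_iff_degree_le_zero] at h
    exact absurd hf (not_lt.2 h)
  have hex : ∀ z ∈ F, ∃ Λ, IsRayLift f z Λ := fun z hz => (hF z hz).2.1.exists_isRayLift
  choose! Λ hΛ using hex
  have hex2 := fun z (hz : z ∈ F) => exists_perpendicular_lift hf hc (hF z hz).2.1 (hΛ z hz)
    (hF z hz).2.2.1 (hF z hz).2.2.2
  choose! σ hσc hσf hσn hσt hσ1 using hex2
  have hfoot : ∀ z ∈ F, ∀ z' ∈ F, ∀ κ : ℝ, 0 < κ → f.eval z' = κ * f.eval z →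
      (f.eval c / f.eval z).re = κ * (f.eval c / f.eval z').re := by
    intro z hz z' hz' κ hκ h
    have : f.eval c / f.eval z' = ((κ⁻¹ : ℝ) : ℂ) * (f.eval c / f.eval z) := by
      rw [h]; push_cast; ring
    rw [this, Complex.re_ofReal_mul, mul_inv_cancel_left₀ hκ.ne']
  have hfoot' : ∀ z ∈ F, ∀ z' ∈ F, ((f.eval c / f.eval z).re : ℂ) * f.eval z =
      ((f.eval c / f.eval z').re : ℂ) * f.eval z' := by
    intro z hz z' hz'
    obtain ⟨κ, hκ, h⟩ := hray z hz z' hz'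
    rw [hfoot z hz z' hz' κ hκ h, h]; push_cast; ring
  -- Lifts that meet at time s agree up to time 1, so the two lifted rays share their point over the
  -- foot. They then coincide up to the scaling κ, and z and z' lie on one lifted ray.
  have hinj : ∀ s ∈ Ioc (0 : ℝ) 1, ∀ z ∈ F, ∀ z' ∈ F, σ z s = σ z' s → z = z' := by
    intro s hs z hz z' hz' hzz
    have h1 : σ z 1 = σ z' 1 := eqOn_of_eval_eq f isPreconnected_Ioc (hσc z hz) (hσc z' hz')
      (hσn z hz) (fun t ht => by rw [hσf z hz t ht, hσf z' hz' t ht, hfoot' z hz z' hz']) hs hzz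
      (right_mem_Ioc.2 zero_lt_one)
    rw [hσ1 z hz, hσ1 z' hz'] at h1
    obtain ⟨κ, hκ, h⟩ := hray z hz z' hz'
    have h2 : Λ z = fun t => Λ z' (t / κ) := by
      have := eqOn_of_eval_eq f (S := univ) (g₁ := Λ z) (g₂ := fun t => Λ z' (t / κ))
        isPreconnected_univ (hΛ z hz).1.continuousOn
        ((hΛ z' hz').1.comp (by fun_prop)).continuousOn
        (fun t _ => (hΛ z hz).derivative_ne_zero (hF z hz).2.1 t)
        (fun t _ => by
          rw [(hΛ z hz).2.2, (hΛ z' hz').2.2, h, ← mul_assoc]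
          congr 1
          have hmax : max (t / κ) 0 * κ = max t 0 := by
            rw [max_mul_of_nonneg _ _ hκ.le, div_mul_cancel₀ _ hκ.ne', zero_mul]
          exact_mod_cast hmax.symm)
        (mem_univ (f.eval c / f.eval z).re)
        (by
          simp only [h1]
          rw [hfoot z hz z' hz' κ hκ h, mul_div_cancel_left₀ _ hκ.ne'])
      exact funext fun t => this (mem_univ t)
    have hz1 : Λ z 1 = z := (hΛ z hz).2.1
    have hzκ : Λ z κ = z' := by
      rw [h2]; simp only [div_self hκ.ne']; exact (hΛ z' hz').2.1
    have hn := (hF z hz).1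
    have hn' := (hF z' hz').1
    -- Both points have modulus r ≥ 1, which strict growth along the ray permits only for κ = 1.
    rcases lt_trichotomy κ 1 with hlt | heq | hgt
    · have := (hΛ z hz).norm_lt_norm hpos (hF z hz).2.1 hκ hlt (by rw [hzκ, hn']; exact hr)
      rw [hz1, hzκ, hn, hn'] at this
      exact absurd this (lt_irrefl _)
    · rw [← hz1, ← hzκ, heq]
    · have := (hΛ z hz).norm_lt_norm hpos (hF z hz).2.1 one_pos hgt (by rw [hz1, hn]; exact hr)
      rw [hz1, hzκ, hn, hn'] at this
      exact absurd this (lt_irrefl _)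
  have hev : ∀ᶠ s : ℝ in 𝓝[>] 0, s ∈ Ioc (0 : ℝ) 1 := Ioc_mem_nhdsGT zero_lt_one
  rcases F.eq_empty_or_nonempty with rfl | ⟨z₀, hz₀⟩
  · simp
  · refine card_le_of_tendsto hf' F (l := 𝓝[>] (0 : ℝ)) (σ := σ) hσt
      (hev.mono fun s hs z hz z' hz' => hinj s hs z hz z' hz')
      (w := fun s => f.eval (σ z₀ s)) (hev.mono fun s hs z hz => ?_)
    rw [hσf z hz s hs, hσf z₀ hz₀ s hs, hfoot' z hz z₀ hz₀]

/-! ### From multiplicity of the angle to measure. -/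

open MeasureTheory in
/-- A set on which an angle function of speed at least `lam` takes every value of the right
half-plane at most `N` times has measure at most `N π / lam`. -/
theorem volume_le_of_multiplicity {E : Set ℝ} (hE : MeasurableSet E) {θ θ' : ℝ → ℝ}
    (hθ : ∀ t, HasDerivAt θ (θ' t) t) {lam : ℝ} (hlam : 0 < lam) (hle : ∀ t, lam ≤ θ' t)
    (hcov : ∀ t ∈ E, ∃ k : ℤ, θ t - 2 * Real.pi * k ∈ Ioo (-(Real.pi / 2)) (Real.pi / 2)) {N : ℕ}
    (hcard : ∀ α ∈ Ioo (-(Real.pi / 2)) (Real.pi / 2), ∀ F : Finset ℝ, (F : Set ℝ) ⊆ E →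
      (∀ t ∈ F, ∃ k : ℤ, θ t = α + 2 * Real.pi * k) → F.card ≤ N) :
    ENNReal.ofReal lam * volume E ≤ N * ENNReal.ofReal Real.pi := by
  classical
  have hmono : StrictMono θ := strictMono_of_deriv_pos fun t => by
    rw [(hθ t).deriv]; exact hlam.trans_le (hle t)
  have hcont : Continuous θ := continuous_iff_continuousAt.2 fun t => (hθ t).continuousAt
  set G := θ '' E with hG
  have hGm : MeasurableSet G := hE.image_of_continuousOn_injOn hcont.continuousOn
    hmono.injective.injOn
  have h1 : ENNReal.ofReal lam * volume E ≤ volume G := by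
    have h := lintegral_image_eq_lintegral_abs_deriv_mul hE
      (fun t _ => (hθ t).hasDerivWithinAt) hmono.injective.injOn (fun _ => 1)
    simp only [lintegral_const, mul_one, one_mul, Measure.restrict_apply, MeasurableSet.univ,
      univ_inter] at h
    rw [h, ← setLIntegral_const]
    exact lintegral_mono fun t => ENNReal.ofReal_le_ofReal ((hle t).trans (le_abs_self _))
  set I := Ioo (-(Real.pi / 2)) (Real.pi / 2) with hI
  -- The image of E is cut along the translates of the half-plane interval by multiples of 2π, and
  -- the pieces are moved back; by `hcard` they cover each angle at most N times.
  have h2 : volume G ≤ ∑' k : ℤ, volume (I ∩ (fun x => x + 2 * Real.pi * k) ⁻¹' G) := by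
    have hsub : G ⊆ ⋃ k : ℤ, (fun x => x + -(2 * Real.pi * k)) ⁻¹'
        (I ∩ (fun x => x + 2 * Real.pi * k) ⁻¹' G) := by
      rintro _ ⟨t, ht, rfl⟩
      obtain ⟨k, hk⟩ := hcov t ht
      refine mem_iUnion.2 ⟨k, ?_, ?_⟩
      · simpa [sub_eq_add_neg] using hk
      · have hmem : θ t ∈ G := ⟨t, ht, rfl⟩
        simpa only [mem_preimage, neg_add_cancel_right] using hmem
    refine (measure_mono hsub).trans ((measure_iUnion_le _).trans ?_)
    exact ENNReal.tsum_le_tsum fun k => (measure_preimage_add_right _ _ _).le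
  have hmk : ∀ k : ℤ, MeasurableSet ((fun x : ℝ => x + 2 * Real.pi * k) ⁻¹' G) := fun k =>
    hGm.preimage (by fun_prop)
  have h3 : ∀ k : ℤ, volume (I ∩ (fun x => x + 2 * Real.pi * k) ⁻¹' G) =
      ∫⁻ x in I, ((fun x : ℝ => x + 2 * Real.pi * k) ⁻¹' G).indicator 1 x := fun k => by
    rw [lintegral_indicator_one (hmk k), Measure.restrict_apply (hmk k), inter_comm]
  have h4 : ∀ x ∈ I, ∑' k : ℤ, ((fun x : ℝ => x + 2 * Real.pi * k) ⁻¹' G).indicator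
      (1 : ℝ → ℝ≥0∞) x ≤ N := by
    intro x hx
    rw [ENNReal.tsum_eq_iSup_sum]
    refine iSup_le fun s => ?_
    have hs : ∑ k ∈ s, ((fun x : ℝ => x + 2 * Real.pi * k) ⁻¹' G).indicator (1 : ℝ → ℝ≥0∞) x =
        ((s.filter fun k : ℤ => x + 2 * Real.pi * k ∈ G).card : ℝ≥0∞) := by
      rw [Finset.card_filter, Nat.cast_sum]
      refine Finset.sum_congr rfl fun k _ => ?_
      simp [indicator_apply]
    rw [hs, Nat.cast_le]
    have hex : ∀ k ∈ s.filter fun k : ℤ => x + 2 * Real.pi * k ∈ G,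
        ∃ t ∈ E, θ t = x + 2 * Real.pi * k := fun k hk => (Finset.mem_filter.1 hk).2
    choose! τ hτE hτ using hex
    rw [← Finset.card_image_of_injOn (f := τ)]
    · refine hcard x hx _ ?_ ?_
      · intro t ht
        obtain ⟨k, hk, rfl⟩ := Finset.mem_image.1 (Finset.mem_coe.1 ht)
        exact hτE k hk
      · intro t ht
        obtain ⟨k, hk, rfl⟩ := Finset.mem_image.1 ht
        exact ⟨k, hτ k hk⟩
    · intro k hk k' hk' h
      have e := (hτ k hk).symm.trans ((congrArg θ h).trans (hτ k' hk'))
      have := mul_left_cancel₀ (by positivity) (add_left_cancel e)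
      exact_mod_cast this
  calc ENNReal.ofReal lam * volume E ≤ volume G := h1
    _ ≤ ∑' k : ℤ, volume (I ∩ (fun x => x + 2 * Real.pi * k) ⁻¹' G) := h2
    _ = ∫⁻ x in I, ∑' k : ℤ, ((fun x : ℝ => x + 2 * Real.pi * k) ⁻¹' G).indicator 1 x := by
      rw [lintegral_tsum fun k => (measurable_one.indicator (hmk k)).aemeasurable]
      exact tsum_congr h3
    _ ≤ ∫⁻ _ in I, N := setLIntegral_mono' measurableSet_Ioo h4
    _ = N * ENNReal.ofReal Real.pi := by
      rw [setLIntegral_const, hI, Real.volume_Ioo]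
      congr 2; ring

/-! ### The argument and the logarithmic derivative of f outside the unit disk. -/

/-- The extreme case is x = -q. With q = 1 / r it gives the contribution r / (1 + r) of each root to
the turning speed of f. -/
theorem inv_one_add_le_re_inv_one_sub {x : ℂ} {q : ℝ} (hx : ‖x‖ ≤ q) (hq : q < 1) :
    1 / (1 + q) ≤ ((1 - x)⁻¹).re := by
  have h0 : 0 ≤ q := (norm_nonneg x).trans hx
  have hre : x.re ≤ q := (Complex.re_le_norm x).trans hx
  have hre' : -q ≤ x.re := (neg_le_neg hx).trans (neg_le_of_abs_le (Complex.abs_re_le_norm x))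
  have hsq : x.re ^ 2 + x.im ^ 2 ≤ q ^ 2 := by
    have := Complex.sq_norm x
    rw [Complex.normSq_apply] at this
    nlinarith [pow_le_pow_left₀ (norm_nonneg x) hx 2]
  rw [Complex.inv_re, Complex.normSq_apply, div_le_div_iff₀ (by linarith)]
  · simp only [Complex.sub_re, Complex.one_re, Complex.sub_im, Complex.one_im]
    nlinarith
  · simp only [Complex.sub_re, Complex.one_re, Complex.sub_im, Complex.one_im]
    nlinarith [mul_self_nonneg (0 - x.im)]

theorem one_sub_mem_slitPlane {x : ℂ} (hx : ‖x‖ < 1) : 1 - x ∈ Complex.slitPlane := by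
  refine Or.inl ?_
  have := Complex.re_le_norm x
  simp only [Complex.sub_re, Complex.one_re]
  linarith

theorem norm_circlePoint {r : ℝ} (hr : 0 ≤ r) (t : ℝ) : ‖circlePoint r t‖ = r := by
  rw [circlePoint, norm_mul, Complex.norm_exp]
  simp [abs_of_nonneg hr]

theorem hasDerivAt_circlePoint (r t : ℝ) :
    HasDerivAt (circlePoint r) (2 * Real.pi * Complex.I * circlePoint r t) t := by
  have h : HasDerivAt (fun t : ℝ => 2 * (Real.pi : ℂ) * Complex.I * (t : ℂ))
      (2 * (Real.pi : ℂ) * Complex.I) t := by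
    simpa using (Complex.ofRealCLM.hasDerivAt (x := t)).const_mul (2 * (Real.pi : ℂ) * Complex.I)
  exact (h.cexp.const_mul (r : ℂ)).congr_deriv (by rw [circlePoint]; ring)

theorem circlePoint_injOn {r : ℝ} (hr : r ≠ 0) : InjOn (circlePoint r) (Ioc 0 1) := by
  intro t ht t' ht' h
  have h1 := mul_left_cancel₀ (by exact_mod_cast hr) h
  obtain ⟨n, hn⟩ := Complex.exp_eq_exp_iff_exists_int.1 h1
  have h2 : (2 * (Real.pi : ℂ) * Complex.I) * t = (2 * (Real.pi : ℂ) * Complex.I) * (t' + n) := by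
    rw [hn]; ring
  have h3 := mul_left_cancel₀ Complex.two_pi_I_ne_zero h2
  have h4 : t = t' + n := by exact_mod_cast h3
  have h5 : (n : ℝ) < 1 := by linarith [ht.2, ht'.1]
  have h6 : (-1 : ℝ) < n := by linarith [ht.1, ht'.2]
  have h7 : n = 0 := by
    have a : n < 1 := by exact_mod_cast h5
    have b : -1 < n := by exact_mod_cast h6
    omega
  simpa [h7] using h4

/-- A smooth choice of the argument of `f z / w` on a circle outside the unit disk. -/
theorem exists_angle_function {d : ℕ} {f : ℂ[X]} (hf : IsPd1 d f) {r : ℝ} (hr : 1 < r) {w : ℂ}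
    (hw : w ≠ 0) : ∃ θ θ' : ℝ → ℝ, (∀ t, HasDerivAt θ (θ' t) t) ∧
      (∀ t, 2 * Real.pi * d * r / (1 + r) ≤ θ' t) ∧
      ∀ t, f.eval (circlePoint r t) / w =
        ‖f.eval (circlePoint r t) / w‖ * Complex.exp (θ t * Complex.I) := by
  obtain ⟨ζ, -, hζ, rfl⟩ := hf
  have hr0 : 0 < r := by linarith
  have hz0 : ∀ t, circlePoint r t ≠ 0 := fun t => norm_pos_iff.1 (by
    rw [norm_circlePoint hr0.le]; exact hr0)
  have hq : ∀ j t, ‖ζ j / circlePoint r t‖ ≤ 1 / r := fun j t => by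
    rw [norm_div, norm_circlePoint hr0.le]
    exact div_le_div_of_nonneg_right (hζ j).le hr0.le
  have hr1 : 1 / r < 1 := (div_lt_one hr0).2 hr
  -- This is a smooth logarithm of f / w: each factor is z (1 - ζ / z), and the principal logarithm
  -- applies to the second part because |ζ / z| < 1. The angle is its imaginary part.
  set L : ℝ → ℂ := fun t => ∑ j, ((Real.log r : ℂ) + 2 * (Real.pi : ℂ) * Complex.I * (t : ℂ) +
    Complex.log (1 - ζ j / circlePoint r t)) - Complex.log w with hL
  have hLd : ∀ t, HasDerivAt L
      (∑ j, 2 * (Real.pi : ℂ) * Complex.I * (1 - ζ j / circlePoint r t)⁻¹) t := by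
    intro t
    refine HasDerivAt.sub_const _ (HasDerivAt.fun_sum fun j _ => ?_)
    have hlin : HasDerivAt (fun t : ℝ => (Real.log r : ℂ) +
        2 * (Real.pi : ℂ) * Complex.I * (t : ℂ)) (2 * (Real.pi : ℂ) * Complex.I) t := by
      simpa using ((Complex.ofRealCLM.hasDerivAt (x := t)).const_mul
        (2 * (Real.pi : ℂ) * Complex.I)).const_add (Real.log r : ℂ)
    have hs := one_sub_mem_slitPlane ((hq j t).trans_lt hr1)
    have hquot : HasDerivAt (fun t : ℝ => 1 - ζ j / circlePoint r t)
        (2 * (Real.pi : ℂ) * Complex.I * (ζ j / circlePoint r t)) t := by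
      have h := ((hasDerivAt_circlePoint r t).inv (hz0 t)).const_mul (ζ j) |>.const_sub 1
      have e : (fun t : ℝ => 1 - ζ j / circlePoint r t) =
          fun t => 1 - ζ j * (circlePoint r t)⁻¹ := by simp only [div_eq_mul_inv]
      rw [e]
      refine h.congr_deriv ?_
      have := hz0 t
      field_simp
    convert hlin.fun_add (hquot.clog_real hs) using 1
    have h1 : 1 - ζ j / circlePoint r t ≠ 0 := Complex.slitPlane_ne_zero hs
    field_simp
    ring
  have hexp : ∀ t, Complex.exp (L t) =
      (∏ j, (X - C (ζ j)) : ℂ[X]).eval (circlePoint r t) / w := by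
    intro t
    rw [hL, Complex.exp_sub, Complex.exp_log hw, Complex.exp_sum, eval_prod]
    congr 1
    refine Finset.prod_congr rfl fun j _ => ?_
    rw [Complex.exp_add, Complex.exp_add, Complex.exp_log (Complex.slitPlane_ne_zero
      (one_sub_mem_slitPlane ((hq j t).trans_lt hr1))), ← Complex.ofReal_exp, Real.exp_log hr0]
    change circlePoint r t * _ = _
    simp only [eval_sub, eval_X, eval_C]
    have := hz0 t
    field_simp
  refine ⟨fun t => (L t).im, fun t =>
    (∑ j, 2 * (Real.pi : ℂ) * Complex.I * (1 - ζ j / circlePoint r t)⁻¹).im,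
    fun t => Complex.imCLM.hasFDerivAt.comp_hasDerivAt t (hLd t), fun t => ?_, fun t => ?_⟩
  · beta_reduce
    rw [Complex.im_sum]
    have hj : ∀ j ∈ Finset.univ, 2 * Real.pi * (r / (1 + r)) ≤
        (2 * (Real.pi : ℂ) * Complex.I * (1 - ζ j / circlePoint r t)⁻¹).im := by
      intro j _
      have h := inv_one_add_le_re_inv_one_sub (hq j t) hr1
      have e : (2 * (Real.pi : ℂ) * Complex.I * (1 - ζ j / circlePoint r t)⁻¹).im =
          2 * Real.pi * ((1 - ζ j / circlePoint r t)⁻¹).re := by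
        simp [Complex.mul_im]
      rw [e]
      refine mul_le_mul_of_nonneg_left ?_ (by positivity)
      calc r / (1 + r) = 1 / (1 + 1 / r) := by field_simp; ring
        _ ≤ _ := h
    have := Finset.card_nsmul_le_sum _ _ _ hj
    rw [Finset.card_univ, Fintype.card_fin, nsmul_eq_mul] at this
    calc 2 * Real.pi * d * r / (1 + r) = d * (2 * Real.pi * (r / (1 + r))) := by ring
      _ ≤ _ := this
  · rw [← hexp, Complex.norm_exp, Complex.ofReal_exp, ← Complex.exp_add, Complex.re_add_im]

/-- The quantity z f' / f is the sum of the terms 1 / (1 - ζ_j / z), each with positive real part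
since |ζ_j / z| < 1. -/
theorem re_logDeriv_pos {d : ℕ} (hd : 1 ≤ d) {f : ℂ[X]} (hf : IsPd1 d f) {z : ℂ} (hz : 1 ≤ ‖z‖) :
    0 < (z * f.derivative.eval z / f.eval z).re := by
  obtain ⟨ζ, -, hζ, rfl⟩ := hf
  have hz0 : z ≠ 0 := norm_pos_iff.1 (by linarith)
  have hlt : ∀ j, ‖ζ j / z‖ < 1 := fun j => by
    rw [norm_div, div_lt_one (by linarith)]; exact (hζ j).trans_le hz
  have hne : ∀ j, z - ζ j ≠ 0 := fun j h => by
    have := hζ j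
    rw [← sub_eq_zero.1 h] at this
    linarith
  have hsum : z * (derivative (∏ j, (X - C (ζ j)))).eval z / (∏ j, (X - C (ζ j))).eval z =
      ∑ j, (1 - ζ j / z)⁻¹ := by
    have h := logDeriv_prod (s := Finset.univ) (f := fun j (z : ℂ) => z - ζ j) (x := z)
      (fun j _ => hne j) (fun j _ => by fun_prop)
    have e : (fun z : ℂ => ∏ j, (z - ζ j)) = fun z => (∏ j, (X - C (ζ j)) : ℂ[X]).eval z := by
      ext z; simp [eval_prod]
    rw [e, logDeriv_apply, Polynomial.deriv] at h
    rw [mul_div_assoc, h, Finset.mul_sum]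
    refine Finset.sum_congr rfl fun j _ => ?_
    rw [logDeriv_apply]
    have h1 := hne j
    have h2 : 1 - ζ j / z = (z - ζ j) / z := by field_simp
    rw [h2, inv_div]
    simp [div_eq_mul_inv]
  rw [hsum, Complex.re_sum]
  have : Nonempty (Fin d) := ⟨⟨0, hd⟩⟩
  refine Finset.sum_pos (fun j _ => ?_) Finset.univ_nonempty
  have := inv_one_add_le_re_inv_one_sub le_rfl (hlt j)
  exact lt_of_lt_of_le (by positivity) this

theorem eval_ne_zero_of_mem_criticalPoints {d : ℕ} {f : ℂ[X]} (hf : IsPd1 d f) {c : ℂ}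
    (hc : c ∈ criticalPoints f) : f.eval c ≠ 0 := by
  obtain ⟨ζ, hinj, -, rfl⟩ := hf
  intro h
  obtain ⟨u, v, huv⟩ := separable_prod_X_sub_C_iff.2 hinj
  have := congrArg (eval c) huv
  have hc' : (derivative (∏ j, (X - C (ζ j)))).eval c = 0 := hc
  simp only [eval_add, eval_mul, h, hc', mul_zero, add_zero, eval_one] at this
  exact zero_ne_one this

theorem eval_ne_zero_of_one_le_norm {d : ℕ} {f : ℂ[X]} (hf : IsPd1 d f) {z : ℂ} (hz : 1 ≤ ‖z‖) :
    f.eval z ≠ 0 := by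
  obtain ⟨ζ, -, hζ, rfl⟩ := hf
  rw [eval_prod, Finset.prod_ne_zero_iff]
  intro j _ h
  rw [eval_sub, eval_X, eval_C, sub_eq_zero] at h
  have := hζ j
  rw [← h] at this
  linarith

theorem natDegree_of_isPd1 {d : ℕ} {f : ℂ[X]} (hf : IsPd1 d f) : f.natDegree = d := by
  obtain ⟨ζ, -, -, rfl⟩ := hf
  simp

/-! ### Measurability of influence. -/

/-- Along a continuous family of endpoints of regular rays, the condition that `c` influences
the orbit is closed. -/
theorem isClosed_influences {f : ℂ[X]} {A : Type*} [TopologicalSpace A] {z : A → ℂ}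
    (hz : Continuous z) (hreg : ∀ t, RegularRay f (z t)) (c : ℂ) :
    IsClosed {t | Influences f c (z t)} := by
  set CV : Set ℂ := f.eval '' {k | f.derivative.eval k = 0} with hCV
  have hmem : ∀ (s : ℝ) (t : A), 0 ≤ s → (s : ℂ) * f.eval (z t) ∈ CVᶜ := by
    rintro s t hs ⟨c, hc, hcs⟩
    exact hreg t c hc s hs hcs.symm
  have cov := f.isCoveringMapOn_eval.isCoveringMap_restrictPreimage
  -- The segments are run backwards, from f z to 0, since the lift is prescribed over f z.
  let H : C(unitInterval × A, (CVᶜ : Set ℂ)) :=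
    ⟨fun q => ⟨((1 - (q.1 : ℝ) : ℝ) : ℂ) * f.eval (z q.2),
      hmem _ _ (sub_nonneg.2 q.1.2.2)⟩, by fun_prop⟩
  let e : C(A, f.eval ⁻¹' CVᶜ) :=
    ⟨fun t => ⟨z t, by simpa using hmem 1 t zero_le_one⟩, by fun_prop⟩
  have H0 : ∀ t, H (0, t) = CVᶜ.restrictPreimage f.eval (e t) := fun t =>
    Subtype.ext (by simp [H, e])
  let M := cov.liftHomotopy H e H0
  have hMf : ∀ (s : unitInterval) (t : A),
      f.eval (M (s, t) : ℂ) = ((1 - (s : ℝ) : ℝ) : ℂ) * f.eval (z t) := fun s t =>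
    congrArg Subtype.val (congrFun (cov.liftHomotopy_lifts H e H0) (s, t))
  have hM0 : ∀ t, (M (0, t) : ℂ) = z t := fun t =>
    congrArg Subtype.val (cov.liftHomotopy_zero H e H0 t)
  have hMn : ∀ q, f.derivative.eval (M q : ℂ) ≠ 0 := fun q h0 => (M q).2 ⟨_, h0, rfl⟩
  have hMc : Continuous fun q => (M q : ℂ) := continuous_subtype_val.comp M.continuous
  have hclosed : IsClosed {q : unitInterval × A | fhat f (M q) ∈ voronoi f (fhat f c)} :=
    (isClosed_preimage_voronoi f (fhat f c)).preimage hMc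
  -- Influence means that some point of the lifted segment lies in the closed Voronoi domain;
  -- projection along the compact unit interval preserves closedness.
  convert isClosedMap_snd_of_compactSpace _ hclosed using 1
  ext t
  have hsc : Continuous fun s : unitInterval => (M (unitInterval.symm s, t) : ℂ) :=
    hMc.comp (by fun_prop)
  constructor
  · rintro ⟨o, ho, p, ⟨γ, hγ, s₀, rfl⟩, hvor⟩
    have hγe : ∀ s : unitInterval, f.eval (coord f (γ s)) = (s : ℝ) * f.eval (z t) := by
      intro s
      rw [← proj_eq_eval_coord, hγ, ho, proj_fhat, AffineMap.lineMap_apply_module]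
      simp
    have hγM := eqOn_of_eval_eq f (S := univ)
      (g₁ := fun s : unitInterval => (M (unitInterval.symm s, t) : ℂ))
      (g₂ := fun s => coord f (γ s)) isPreconnected_univ hsc.continuousOn
      ((continuous_coord f).comp γ.continuous).continuousOn (fun s _ => hMn _)
      (fun s _ => by rw [hMf, hγe]; simp) (mem_univ 1) (by simp [hM0, coord_fhat])
    refine ⟨(unitInterval.symm s₀, t), ?_, rfl⟩
    have h1 : (M (unitInterval.symm s₀, t) : ℂ) = coord f (γ s₀) := hγM (mem_univ s₀)
    rw [mem_ofPred_eq, h1, fhat_coord]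
    exact hvor
  · rintro ⟨⟨s₀, t'⟩, hs₀, rfl⟩
    refine ⟨fhat f (M (1, t')), by rw [proj_fhat, hMf]; simp, fhat f (M (s₀, t')),
      ⟨⟨⟨fun s => fhat f (M (unitInterval.symm s, t')), (continuous_fhat f).comp hsc⟩,
        by simp, by simp [hM0]⟩, fun s => ?_, unitInterval.symm s₀, ?_⟩, hs₀⟩
    · change f.eval (M (unitInterval.symm s, t') : ℂ) = _
      rw [proj_fhat, proj_fhat, hMf, hMf, AffineMap.lineMap_apply_module]
      simp
    · change fhat f (M (unitInterval.symm (unitInterval.symm s₀), t')) = _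
      rw [unitInterval.symm_symm]

theorem measurableSet_influences {f : ℂ[X]} {z : ℝ → ℂ} (hz : Continuous z)
    (hreg : MeasurableSet {t | RegularRay f (z t)}) (c : ℂ) :
    MeasurableSet {t | RegularRay f (z t) ∧ Influences f c (z t)} := by
  have h := hreg.subtype_image (isClosed_influences (A := {t | RegularRay f (z t)})
    (z := fun t => z t) (hz.comp continuous_subtype_val) (fun t => t.2) c).measurableSet
  convert h using 1
  ext t
  exact ⟨fun ht => ⟨⟨t, ht.1⟩, ht.2, rfl⟩, by rintro ⟨⟨t, h1⟩, h2, rfl⟩; exact ⟨h1, h2⟩⟩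

/-- The value f c lies on the ray exactly when f z / f c is a nonnegative real. The slit plane turns
regularity into finitely many open conditions on z when f' ≠ 0. -/
theorem regularRay_iff {f : ℂ[X]} (h0 : ∀ c ∈ criticalPoints f, f.eval c ≠ 0) {z : ℂ}
    (hz : f.eval z ≠ 0) :
    RegularRay f z ↔ ∀ c ∈ criticalPoints f, -(f.eval z / f.eval c) ∈ Complex.slitPlane := by
  refine forall₂_congr fun c hc => ?_
  constructor
  · intro h
    by_contra hcon
    rw [Complex.mem_slitPlane_iff_not_le_zero, not_not, Complex.le_def] at hcon
    simp only [Complex.neg_re, Complex.neg_im, Complex.zero_re, Complex.zero_im, neg_nonpos,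
      neg_eq_zero] at hcon
    have hreal : f.eval z / f.eval c = ((f.eval z / f.eval c).re : ℂ) :=
      Complex.ext rfl (by simp [hcon.2])
    refine h ((f.eval z / f.eval c).re)⁻¹ (inv_nonneg.2 hcon.1) ?_
    rw [Complex.ofReal_inv, ← hreal, inv_div, div_mul_cancel₀ _ hz]
  · intro h s hs hsz
    have hs0 : (s : ℂ) ≠ 0 := by
      intro h1
      rw [h1, zero_mul] at hsz
      exact h0 c hc hsz.symm
    have : -(f.eval z / f.eval c) = ((-s⁻¹ : ℝ) : ℂ) := by
      rw [← hsz]; push_cast; field_simp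
    rw [this, Complex.ofReal_mem_slitPlane] at h
    have := inv_nonneg.2 hs
    linarith

/-! ### Integration over the circle. -/

open MeasureTheory

theorem continuous_circlePoint (r : ℝ) : Continuous (circlePoint r) := by
  unfold circlePoint; fun_prop

section Circle

variable {d : ℕ} {f : ℂ[X]} {r : ℝ}

theorem eval_circlePoint_ne_zero (hf : IsPd1 d f) (hr : 1 < r) (t : ℝ) :
    f.eval (circlePoint r t) ≠ 0 :=
  eval_ne_zero_of_one_le_norm hf (by rw [norm_circlePoint (by linarith)]; exact hr.le)

theorem derivative_ne_zero_of_isPd1 (hd : 1 ≤ d) (hf : IsPd1 d f) : f.derivative ≠ 0 := by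
  rw [Ne, derivative_eq_zero, natDegree_of_isPd1 hf]
  omega

theorem coe_roots_derivative (hd : 1 ≤ d) (hf : IsPd1 d f) :
    (f.derivative.roots.toFinset : Set ℂ) = criticalPoints f := by
  ext c
  simp [criticalPoints, derivative_ne_zero_of_isPd1 hd hf]

theorem measurableSet_regularRay (hd : 1 ≤ d) (hf : IsPd1 d f) (hr : 1 < r) :
    MeasurableSet {t | RegularRay f (circlePoint r t)} := by
  have h : {t | RegularRay f (circlePoint r t)} = ⋂ c ∈ f.derivative.roots.toFinset,
      {t | -(f.eval (circlePoint r t) / f.eval c) ∈ Complex.slitPlane} := by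
    ext t
    simp only [mem_iInter, mem_ofPred_eq]
    rw [regularRay_iff (fun c => eval_ne_zero_of_mem_criticalPoints hf)
      (eval_circlePoint_ne_zero hf hr t), ← coe_roots_derivative hd hf]
    rfl
  rw [h]
  refine Finset.measurableSet_biInter _ fun c _ => ?_
  have hc : Continuous fun t => -(f.eval (circlePoint r t) / f.eval c) :=
    ((f.continuous.comp (continuous_circlePoint r)).div_const _).neg
  exact (Complex.isOpen_slitPlane.preimage hc).measurableSet

/-- An irregular parameter is one where the angle from some f c to f z is a multiple of 2π. Each
such angle is strictly increasing in t, so these parameters are countable. -/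
theorem ae_regularRay (hd : 1 ≤ d) (hf : IsPd1 d f) (hr : 1 < r) :
    ∀ᵐ t : ℝ, RegularRay f (circlePoint r t) := by
  have hr0 : 0 < r := by linarith
  have hex := fun c (hc : c ∈ criticalPoints f) =>
    exists_angle_function hf hr (eval_ne_zero_of_mem_criticalPoints hf hc)
  choose! θ θ' hθ hθ' hθe using hex
  have hinj : ∀ c ∈ criticalPoints f, Function.Injective (θ c) := fun c hc =>
    (strictMono_of_deriv_pos fun t => by
      rw [(hθ c hc t).deriv]
      refine lt_of_lt_of_le ?_ (hθ' c hc t)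
      have : (0 : ℝ) < d := by exact_mod_cast hd
      positivity).injective
  have hsub : {t | ¬ RegularRay f (circlePoint r t)} ⊆
      ⋃ c ∈ criticalPoints f, θ c ⁻¹' range (fun n : ℤ => (n : ℝ) * (2 * Real.pi)) := by
    intro t ht
    rw [mem_ofPred_eq, RegularRay] at ht
    push Not at ht
    obtain ⟨c, hc, s, hs, hst⟩ := ht
    have hc0 := eval_ne_zero_of_mem_criticalPoints hf hc
    have hs0 : (s : ℂ) ≠ 0 := by
      intro h
      rw [h, zero_mul] at hst
      exact hc0 hst.symm
    have hquot : f.eval (circlePoint r t) / f.eval c = (s : ℂ)⁻¹ := by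
      have := eval_circlePoint_ne_zero hf hr t
      rw [← hst]; field_simp
    have h := hθe c hc t
    rw [hquot, norm_inv, Complex.norm_real, Real.norm_of_nonneg hs, Complex.ofReal_inv] at h
    have h1 : Complex.exp (θ c t * Complex.I) = 1 := by
      have := inv_ne_zero hs0
      exact mul_left_cancel₀ this (by rw [mul_one]; exact h.symm)
    obtain ⟨n, hn⟩ := Complex.exp_eq_one_iff.1 h1
    refine mem_iUnion₂.2 ⟨c, hc, n, ?_⟩
    have h2 : (θ c t : ℂ) * Complex.I = ((n * (2 * Real.pi) : ℝ) : ℂ) * Complex.I := by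
      rw [hn]; push_cast; ring
    have h3 := mul_right_cancel₀ Complex.I_ne_zero h2
    exact (Complex.ofReal_injective h3).symm
  refine measure_mono_null hsub (Set.Countable.measure_zero ?_ _)
  refine Set.Countable.biUnion ?_ fun c hc => (countable_range _).preimage_of_injOn (hinj c hc).injOn
  rw [← coe_roots_derivative hd hf]
  exact Finset.countable_toSet _

/-- The parameters of the points on a circle whose orbits are influenced by `c` and that are counted
by `betaPlus`, up to the points on irregular rays. -/
def influenceSet (f : ℂ[X]) (r : ℝ) (c : ℂ) : Set ℝ :=
  {t | t ∈ Ioc (0 : ℝ) 1 ∧ (RegularRay f (circlePoint r t) ∧ Influences f c (circlePoint r t)) ∧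
    0 < (f.eval (circlePoint r t) / f.eval c).re}

theorem measurableSet_influenceSet (hd : 1 ≤ d) (hf : IsPd1 d f) (hr : 1 < r) (c : ℂ) :
    MeasurableSet (influenceSet f r c) := by
  have hc : Continuous fun t => (f.eval (circlePoint r t) / f.eval c).re :=
    Complex.continuous_re.comp ((f.continuous.comp (continuous_circlePoint r)).div_const _)
  exact measurableSet_Ioc.inter ((measurableSet_influences (continuous_circlePoint r)
    (measurableSet_regularRay hd hf hr) c).inter (isOpen_lt continuous_const hc).measurableSet)

theorem volume_influenceSet_le (hd : 1 ≤ d) (hf : IsPd1 d f) (hr : 1 < r) {c : ℂ}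
    (hc : c ∈ criticalPoints f) :
    volume (influenceSet f r c) ≤
      ENNReal.ofReal ((f.derivative.rootMultiplicity c + 1) * ((1 + r) / (2 * d * r))) := by
  have hr0 : 0 < r := by linarith
  have hd0 : (0 : ℝ) < d := by exact_mod_cast hd
  have hdeg : 0 < f.degree := natDegree_pos_iff_degree_pos.1 (by
    rw [natDegree_of_isPd1 hf]; exact hd)
  have hc0 := eval_ne_zero_of_mem_criticalPoints hf hc
  obtain ⟨θ, θ', hθ, hθ', hθe⟩ := exists_angle_function hf hr hc0
  set lam := 2 * Real.pi * d * r / (1 + r) with hlam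
  have hlam0 : 0 < lam := by positivity
  have hmain := volume_le_of_multiplicity (measurableSet_influenceSet hd hf hr c) hθ hlam0 hθ'
    (N := f.derivative.rootMultiplicity c + 1) ?_ ?_
  · have h1 : volume (influenceSet f r c) ≤
        ((f.derivative.rootMultiplicity c + 1 : ℕ) * ENNReal.ofReal Real.pi) /
          ENNReal.ofReal lam := by
      rw [ENNReal.le_div_iff_mul_le (Or.inl (by simpa using hlam0)) (Or.inl ENNReal.ofReal_ne_top),
        mul_comm]
      exact hmain
    refine h1.trans (le_of_eq ?_)
    rw [← ENNReal.ofReal_natCast, ← ENNReal.ofReal_mul (by positivity),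
      ← ENNReal.ofReal_div_of_pos hlam0, hlam]
    congr 1
    have := Real.pi_ne_zero
    push_cast
    field_simp
  · rintro t ⟨-, -, hre⟩
    set q := f.eval (circlePoint r t) / f.eval c with hq
    have hq0 : q ≠ 0 := fun h => by simp [h] at hre
    have harg := Complex.abs_arg_lt_pi_div_two_iff.2 (Or.inl hre)
    have h1 : Complex.exp (θ t * Complex.I) = Complex.exp (Complex.arg q * Complex.I) := by
      have h2 := (hθe t).symm.trans (Complex.norm_mul_exp_arg_mul_I q).symm
      exact mul_left_cancel₀ (by exact_mod_cast norm_ne_zero_iff.2 hq0) h2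
    obtain ⟨k, hk⟩ := Complex.exp_eq_exp_iff_exists_int.1 h1
    have h3 : (θ t : ℂ) * Complex.I =
        ((Complex.arg q + 2 * Real.pi * k : ℝ) : ℂ) * Complex.I := by
      rw [hk]; push_cast; ring
    have h4 := Complex.ofReal_injective (mul_right_cancel₀ Complex.I_ne_zero h3)
    refine ⟨k, ?_⟩
    rw [h4, add_sub_cancel_right]
    exact abs_lt.1 harg
  · intro α _ F hFE hFα
    classical
    have hray : ∀ t ∈ F, f.eval (circlePoint r t) / f.eval c =
        ‖f.eval (circlePoint r t) / f.eval c‖ * Complex.exp (α * Complex.I) := by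
      intro t ht
      obtain ⟨k, hk⟩ := hFα t ht
      have : Complex.exp (θ t * Complex.I) = Complex.exp (α * Complex.I) := by
        refine Complex.exp_eq_exp_iff_exists_int.2 ⟨k, ?_⟩
        rw [hk]; push_cast; ring
      rw [← this]; exact hθe t
    have hcard : (F.image (circlePoint r)).card = F.card :=
      Finset.card_image_of_injOn ((circlePoint_injOn hr0.ne').mono fun t ht => (hFE ht).1)
    rw [← hcard]
    refine card_influenced_le hdeg (fun z hz => re_logDeriv_pos hd hf hz) hc hr.le _ ?_ ?_
    · intro z hz
      obtain ⟨t, ht, rfl⟩ := Finset.mem_image.1 hz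
      obtain ⟨-, ⟨h1, h2⟩, h3⟩ := hFE ht
      refine ⟨norm_circlePoint hr0.le t, h1, h2, ?_⟩
      rw [← inv_div, Complex.inv_re]
      exact div_pos h3 (Complex.normSq_pos.2 fun h => by simp [h] at h3)
    · intro z hz z' hz'
      obtain ⟨t, ht, rfl⟩ := Finset.mem_image.1 hz
      obtain ⟨t', ht', rfl⟩ := Finset.mem_image.1 hz'
      have hz0 := eval_circlePoint_ne_zero hf hr t
      have hz0' := eval_circlePoint_ne_zero hf hr t'
      obtain ⟨x, hx, e⟩ : ∃ x : ℝ, 0 < x ∧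
          f.eval (circlePoint r t) / f.eval c = x * Complex.exp (α * Complex.I) :=
        ⟨_, norm_pos_iff.2 (div_ne_zero hz0 hc0), hray t ht⟩
      obtain ⟨y, hy, e'⟩ : ∃ y : ℝ, 0 < y ∧
          f.eval (circlePoint r t') / f.eval c = y * Complex.exp (α * Complex.I) :=
        ⟨_, norm_pos_iff.2 (div_ne_zero hz0' hc0), hray t' ht'⟩
      have hxC : (x : ℂ) ≠ 0 := by exact_mod_cast hx.ne'
      refine ⟨y / x, by positivity, ?_⟩
      rw [← div_left_inj' hc0, e', mul_div_assoc, e, Complex.ofReal_div]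
      field_simp

theorem betaPlus_eq_sum_indicator (hd : 1 ≤ d) (hf : IsPd1 d f) (hr : 1 < r) {t : ℝ}
    (ht : t ∈ Ioc (0 : ℝ) 1) (hreg : RegularRay f (circlePoint r t)) :
    (betaPlus f (circlePoint r t) : ℝ) =
      ∑ c ∈ f.derivative.roots.toFinset, (influenceSet f r c).indicator (fun _ => (1 : ℝ)) t := by
  classical
  have h : {c ∈ criticalPoints f | Influences f c (circlePoint r t) ∧
      -(Real.pi / 2) < angle f (circlePoint r t) c ∧ angle f (circlePoint r t) c < Real.pi / 2} =
      ((f.derivative.roots.toFinset.filter fun c => t ∈ influenceSet f r c : Finset ℂ) : Set ℂ) := by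
    ext c
    rw [Finset.coe_filter]
    simp only [mem_ofPred_eq]
    rw [← Finset.mem_coe, coe_roots_derivative hd hf]
    refine and_congr_right fun hc => ?_
    have hq0 : f.eval (circlePoint r t) / f.eval c ≠ 0 := div_ne_zero
      (eval_circlePoint_ne_zero hf hr t) (eval_ne_zero_of_mem_criticalPoints hf hc)
    rw [← abs_lt, angle, Complex.abs_arg_lt_pi_div_two_iff]
    simp only [influenceSet, mem_ofPred_eq, ht, hreg, true_and, hq0, or_false]
  rw [betaPlus, h, Set.ncard_coe_finset, Finset.card_filter, Nat.cast_sum]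
  refine Finset.sum_congr rfl fun c _ => ?_
  simp [indicator_apply]

/-- Every critical point has m ≥ 1, so m + 1 ≤ 2m, and the m sum to at most deg f'. The cruder bound
d is what cancels the d in the measure estimate. -/
theorem sum_rootMultiplicity_derivative_le (hd : 1 ≤ d) (hf : IsPd1 d f) :
    ∑ c ∈ f.derivative.roots.toFinset, ((f.derivative.rootMultiplicity c : ℝ) + 1) ≤ 2 * d := by
  have h1 : ∑ c ∈ f.derivative.roots.toFinset, f.derivative.rootMultiplicity c ≤ d := by
    simp_rw [← count_roots]
    rw [Multiset.toFinset_sum_count_eq]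
    refine (card_roots' _).trans ((natDegree_derivative_le f).trans ?_)
    rw [natDegree_of_isPd1 hf]
    omega
  calc ∑ c ∈ f.derivative.roots.toFinset, ((f.derivative.rootMultiplicity c : ℝ) + 1)
      ≤ ∑ c ∈ f.derivative.roots.toFinset, 2 * (f.derivative.rootMultiplicity c : ℝ) := by
        refine Finset.sum_le_sum fun c hc => ?_
        have hpos : 0 < f.derivative.rootMultiplicity c := by
          rw [← count_roots, Multiset.count_pos]
          exact Multiset.mem_toFinset.1 hc
        have : (1 : ℝ) ≤ f.derivative.rootMultiplicity c := by exact_mod_cast hpos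
        linarith
    _ ≤ 2 * d := by
        rw [← Finset.mul_sum]
        gcongr
        exact_mod_cast h1

end Circle

end PathLifting

open PathLifting MeasureTheory in
theorem proposition8p3 (d : ℕ) (hd : 1 ≤ d) (f : Polynomial ℂ) (hf : PathLifting.IsPd1 d f)
    (r : ℝ) (hr : 1 < r) :
    IntervalIntegrable (fun t : ℝ => (PathLifting.betaPlus f (PathLifting.circlePoint r t) : ℝ))
      MeasureTheory.volume 0 1 ∧
    ∫ t in (0 : ℝ)..1, (PathLifting.betaPlus f (PathLifting.circlePoint r t) : ℝ)
      ≤ (1 + r) / r := by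
  have hr0 : 0 < r := by linarith
  have hd0 : (0 : ℝ) < d := by exact_mod_cast hd
  -- Integrability of β⁺ is inherited from this finite sum of indicators of measurable sets, which
  -- differs from it only on irregular rays.
  have hae : (fun t => ∑ c ∈ f.derivative.roots.toFinset,
      (influenceSet f r c).indicator (fun _ => (1 : ℝ)) t) =ᵐ[volume.restrict (Ioc 0 1)]
      fun t : ℝ => (betaPlus f (circlePoint r t) : ℝ) := by
    filter_upwards [ae_restrict_mem measurableSet_Ioc, ae_restrict_of_ae (ae_regularRay hd hf hr)]
      with t ht hreg using (betaPlus_eq_sum_indicator hd hf hr ht hreg).symm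
  have hint : ∀ c ∈ f.derivative.roots.toFinset, Integrable
      ((influenceSet f r c).indicator fun _ => (1 : ℝ)) (volume.restrict (Ioc 0 1)) := fun c _ =>
    (integrable_const _).indicator (measurableSet_influenceSet hd hf hr c)
  rw [intervalIntegrable_iff_integrableOn_Ioc_of_le zero_le_one,
    intervalIntegral.integral_of_le zero_le_one, ← integral_congr_ae hae]
  refine ⟨(integrable_finsetSum _ hint).congr hae, ?_⟩
  rw [integral_finsetSum _ hint]
  calc ∑ c ∈ f.derivative.roots.toFinset, ∫ t in Ioc (0 : ℝ) 1,
        (influenceSet f r c).indicator (fun _ => (1 : ℝ)) t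
      ≤ ∑ c ∈ f.derivative.roots.toFinset,
        ((f.derivative.rootMultiplicity c : ℝ) + 1) * ((1 + r) / (2 * d * r)) := by
        refine Finset.sum_le_sum fun c hc => ?_
        have hE := measurableSet_influenceSet hd hf hr c
        rw [integral_indicator hE, setIntegral_const, smul_eq_mul, mul_one,
          measureReal_restrict_apply hE, inter_eq_left.2 fun t ht => ht.1]
        refine ENNReal.toReal_le_of_le_ofReal (by positivity) (volume_influenceSet_le hd hf hr ?_)
        rw [← coe_roots_derivative hd hf]
        exact hc
    _ ≤ 2 * d * ((1 + r) / (2 * d * r)) := by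
        rw [← Finset.sum_mul]
        exact mul_le_mul_of_nonneg_right (sum_rootMultiplicity_derivative_le hd hf) (by positivity)
    _ = (1 + r) / r := by field_simp
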